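/- Throughout, for $x\in\mathbb R^n$ and $L\in O(n)$, $[x,L]$ denotes the isometry $z\mapsto L(z+x)$ of $\mathbb R^n$. Let $\Gamma$ be a crystal group, i.e. a discrete subgroup of the group $I(\mathbb R^n)$ of isometries of $\mathbb R^n$ whose orbit space $\mathbb R^n/\Gamma$ is compact. Let $T=\{[y,\mathrm{id}]\in\Gamma\}$ be its translation subgroup, $\Pi=\{L:[x,L]\in\Gamma \text{ for some } x\}$ its point group, and $\gamma:\Pi\to\Gamma$ a cross-section of $[x,L]\mapsto L$ with $\gamma(\mathrm{id})=[0,\mathrm{id}]$. Let $\mathcal L=\{x:[x,\mathrm{id}]\in\Gamma\}$, $\mathcal L^*=\{z\in\mathbb R^n: x\cdot z\in\mathbb Z\ \text{for all } x\in\mathcal L\}$, $\Gamma^*=\{[z,L]:z\in\mathcal L^*,\,L\in\Pi\}$ and $T^*=\{[z,\mathrm{id}]:z\in\mathcal L^*\}$. Let $R$ be a Dirichlet fundamental domain for $\Gamma^*$: for some $a\in\mathbb R^n$ with trivial stabilizer in $\Gamma^*$, $$R=\{y\in\mathbb R^n:\ |y-a|<|y-ga|\ \text{ for all } g\in\Gamma^*,\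 g\neq[0,\mathrm{id}]\}.$$ Let $\Omega_{T^*}$ be a fundamental set for $T^*$ (a set meeting each $T^*$-orbit in exactly one point) with $\Pi R\subseteq\Omega_{T^*}\subseteq\Pi\overline R$. The group $\Pi$ acts on $\Omega_{T^*}$: $L\in\Pi$ sends $\omega$ to the unique element of $(L\omega+\mathcal L^*)\cap\Omega_{T^*}$. Let $\Omega\subseteq\Omega_{T^*}$ be a transversal for this action (a set meeting each orbit in exactly one point) with $R\subseteq\Omega\subseteq\overline R$. For $\omega\in\mathbb R^n$ let $\chi_\omega^T([y,\mathrm{id}])=e^{2\pi i\,\omega\cdot y}$, a character of $T$, and let $\Gamma_\omega=\{g\in\Gamma:\chi^T_\omega(g^{-1}tg)=\chi_\omega^T(t)\ \text{for all } t\in T\}$ be its stabilizer. Let $\widehat{\Gamma_\omega}^{\,\omega}$ be the set of unitary equivalence classes of irreducible unitary representations of $\Gamma_\omega$ whose restriction to $T$ is a multiple of $\chi_\omega^T$. For a subgroup $H\le\Gamma$ and a unitary representation $\sigma$ of $H$ on $\mathscr H_\sigma$, let $\mathrm{ind}_H^\Gamma\sigma$ be the representation of $\Gamma$ by $(\mathrm{ind}_H^\Gamma\sigma)(g)f(x)=f(g^{-1}x)$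 on the Hilbert space of functions $f:\Gamma\to\mathscr H_\sigma$ with $f(xh)=\sigma(h^{-1})f(x)$ for $x\in\Gamma$, $h\in H$ and $\sum_{xH\in\Gamma/H}\|f(x)\|^2<\infty$, with inner product $\langle f,g\rangle=\sum_{xH\in\Gamma/H}\langle f(x),g(x)\rangle$. Let $U^{\chi_\omega^T}=W(\mathrm{ind}_T^\Gamma\chi_\omega^T)W^{-1}$ on $\ell^2(\Pi)$, where $(Wf)(L)=f(\gamma(L))$. Then $\Omega\setminus R$ has Lebesgue measure zero, and the dual $\widehat\Gamma$ (the set of unitary equivalence classes of irreducible unitary representations of $\Gamma$) is $$\widehat\Gamma=\big\{[U^{\chi_\omega^T}]:\omega\in R\big\}\ \cup\bigcup_{\omega\in\Omega\setminus R}\big\{[\mathrm{ind}_{\Gamma_\omega}^\Gamma\sigma]:\sigma\in\widehat{\Gamma_\omega}^{\,\omega}\big\}.$$ -/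

import Mathlib

open scoped ENNReal

noncomputable section

namespace Crystal

/-! ### Unitary representations of a discrete group, equivalence, irreducibility, dual -/

/-- A unitary representation of the group `G` (regarded as a discrete group, so that continuity
is automatic) on a complex Hilbert space. -/
structure UnitaryRep (G : Type) [Group G] where
  /-- the underlying Hilbert space -/
  H : Type
  [instNormed : NormedAddCommGroup H]
  [instInner : InnerProductSpace ℂ H]
  [instComplete : CompleteSpace H]
  /-- the action by unitary operators -/
  act : G →* (H ≃ₗᵢ[ℂ] H)

attribute [instance] UnitaryRep.instNormed UnitaryRep.instInner UnitaryRep.instComplete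

namespace UnitaryRep

variable {G : Type} [Group G]

/-- Unitary equivalence. -/
def Equivalent (π σ : UnitaryRep G) : Prop :=
  ∃ U : π.H ≃ₗᵢ[ℂ] σ.H, ∀ (g : G) (v : π.H), U (π.act g v) = σ.act g (U v)

instance setoid (G : Type) [Group G] : Setoid (UnitaryRep G) where
  r := Equivalent
  iseqv :=
    { refl := fun π => ⟨LinearIsometryEquiv.refl ℂ π.H, fun _ _ => rfl⟩
      symm := by
        rintro π σ ⟨U, hU⟩
        refine ⟨U.symm, fun g v => ?_⟩
        apply U.injective
        rw [hU, U.apply_symm_apply, U.apply_symm_apply]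
      trans := by
        rintro π σ τ ⟨U, hU⟩ ⟨V, hV⟩
        refine ⟨U.trans V, fun g v => ?_⟩
        simp only [LinearIsometryEquiv.trans_apply, hU, hV] }

/-- `π` is irreducible: its space is nonzero, and `{0}` and the whole space are the only
invariant closed subspaces. -/
def IsIrreducible (π : UnitaryRep G) : Prop :=
  Nontrivial π.H ∧ ∀ K : Submodule ℂ π.H, IsClosed (K : Set π.H) →
    (∀ g : G, ∀ v ∈ K, π.act g v ∈ K) → K = ⊥ ∨ K = ⊤

/-- The restriction of a representation along a homomorphism. -/
def restrict {K : Type} [Group K] (π : UnitaryRep G) (j : K →* G) : UnitaryRep K where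
  H := π.H
  act := π.act.comp j

/-- `σ` is (equivalent to) a multiple of `ρ`: the Hilbert space of `σ` is identified with the
Hilbert direct sum of copies of the space of `ρ` indexed by some set `I`, and `σ` acts as `ρ`
in each summand. -/
def IsMultipleOf (σ ρ : UnitaryRep G) : Prop :=
  ∃ (I : Type) (U : σ.H ≃ₗᵢ[ℂ] lp (fun _ : I => ρ.H) 2),
    ∀ (g : G) (v : σ.H) (i : I), U (σ.act g v) i = ρ.act g (U v i)

/-- The representation `g ↦ V π(g) V⁻¹` on `K`, for a unitary `V` from the space of `π` onto
`K`. -/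
def transport (π : UnitaryRep G) {K : Type} [NormedAddCommGroup K] [InnerProductSpace ℂ K]
    [CompleteSpace K] (V : π.H ≃ₗᵢ[ℂ] K) : UnitaryRep G where
  H := K
  act :=
    { toFun := fun g => (V.symm.trans (π.act g)).trans V
      map_one' := by
        rw [map_one]
        exact LinearIsometryEquiv.ext V.apply_symm_apply
      map_mul' := fun g h => by
        rw [map_mul]
        refine LinearIsometryEquiv.ext fun v => ?_
        change V (π.act g (π.act h (V.symm v))) =
          V (π.act g (V.symm (V (π.act h (V.symm v)))))
        rw [LinearIsometryEquiv.symm_apply_apply] }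

/-- The one-dimensional representation on `ℂ` given by a character. -/
def ofCharacter (χ : G →* Circle) : UnitaryRep G where
  H := ℂ
  act :=
    { toFun := fun g =>
        { toFun := fun z => (χ g : ℂ) * z
          invFun := fun z => ((χ g)⁻¹ : Circle) * z
          map_add' := fun x y => mul_add _ x y
          map_smul' := fun c x => by simp only [smul_eq_mul, RingHom.id_apply]; ring
          left_inv := fun z => by simp
          right_inv := fun z => by simp
          norm_map' := fun z => by
            change ‖(χ g : ℂ) * z‖ = ‖z‖
            rw [norm_mul, Circle.norm_coe, one_mul] }
      map_one' := by ext; simp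
      map_mul' := fun g h => by
        ext
        simp [mul_assoc] }

end UnitaryRep

/-- Equivalence classes of unitary representations. -/
abbrev RepClass (G : Type) [Group G] := Quotient (UnitaryRep.setoid G)

/-- The equivalence class `[π]`. -/
def repClass {G : Type} [Group G] (π : UnitaryRep G) : RepClass G := Quotient.mk _ π

/-- The dual `Ĝ`: the set of equivalence classes of irreducible unitary representations. -/
def dual (G : Type) [Group G] : Set (RepClass G) :=
  {c | ∃ π : UnitaryRep G, π.IsIrreducible ∧ c = repClass π}

/-! ### Induced representations -/

section Induced

variable {G : Type} [Group G] {H : Subgroup G} (σ : UnitaryRep H)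

/-- The functions `f : G → H_σ` with `f (x h) = σ(h⁻¹) f (x)` for `x ∈ G`, `h ∈ H`, which are
square-summable over `G / H` (`‖f x‖` depends only on the coset `x H`). -/
def indSubmodule : Submodule ℂ (G → σ.H) where
  carrier := {f | (∀ (x : G) (h : H), f (x * h) = σ.act h⁻¹ (f x)) ∧
    Memℓp (fun q : G ⧸ H => f q.out) 2}
  zero_mem' := ⟨fun x h => by simp, zero_memℓp⟩
  add_mem' := by
    rintro f g ⟨hf, hf'⟩ ⟨hg, hg'⟩
    exact ⟨fun x h => by simp [hf, hg], hf'.add hg'⟩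
  smul_mem' := by
    rintro c f ⟨hf, hf'⟩
    exact ⟨fun x h => by simp [hf], hf'.const_smul c⟩

/-- The space of the induced representation. -/
def IndSpace : Type := indSubmodule σ

instance : AddCommGroup (IndSpace σ) := inferInstanceAs (AddCommGroup (indSubmodule σ))
instance : Module ℂ (IndSpace σ) := inferInstanceAs (Module ℂ (indSubmodule σ))
instance : CoeFun (IndSpace σ) (fun _ => G → σ.H) := ⟨fun f => f.1⟩

variable {σ}

theorem IndSpace.ext {f g : IndSpace σ} (h : ∀ x, f x = g x) : f = g :=
  Subtype.ext (funext h)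

theorem IndSpace.map_mul (f : IndSpace σ) (x : G) (h : H) : f (x * h) = σ.act h⁻¹ (f x) :=
  f.2.1 x h

theorem norm_eq_of_equivariant {f : G → σ.H}
    (hf : ∀ (x : G) (h : H), f (x * h) = σ.act h⁻¹ (f x)) {x y : G}
    (hxy : (x : G ⧸ H) = y) : ‖f x‖ = ‖f y‖ := by
  have h1 := hf x ⟨x⁻¹ * y, QuotientGroup.eq.1 hxy⟩
  simp only [mul_inv_cancel_left] at h1
  rw [h1, LinearIsometryEquiv.norm_map]

/-- For an equivariant function, square-summability may be tested on any system of
representatives `s` of `G / H`. -/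
theorem memlp_section_iff {f : G → σ.H}
    (hf : ∀ (x : G) (h : H), f (x * h) = σ.act h⁻¹ (f x)) {I : Type} {s : I → G}
    (hs : Function.Bijective fun i => (s i : G ⧸ H)) :
    Memℓp (fun i => f (s i)) 2 ↔ Memℓp (fun q : G ⧸ H => f q.out) 2 := by
  have h0 : 0 < (2 : ℝ≥0∞).toReal := by norm_num
  rw [memℓp_gen_iff h0, memℓp_gen_iff h0,
    ← (Equiv.ofBijective _ hs).summable_iff]
  have : ∀ i, ‖f (s i)‖ = ‖f (s i : G ⧸ H).out‖ := fun i =>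
    norm_eq_of_equivariant hf (Quotient.out_eq' _).symm
  simp only [this]
  rfl

/-- The equivariant function on `G` with prescribed values on representatives of the cosets. -/
def extendSection {I : Type} {s : I → G} (hs : Function.Bijective fun i => (s i : G ⧸ H))
    (ζ : I → σ.H) (x : G) : σ.H :=
  σ.act ⟨(s ((Equiv.ofBijective _ hs).symm (x : G ⧸ H)))⁻¹ * x,
      QuotientGroup.eq.1 ((Equiv.ofBijective _ hs).apply_symm_apply (x : G ⧸ H))⟩⁻¹
    (ζ ((Equiv.ofBijective _ hs).symm (x : G ⧸ H)))

theorem extendSection_mul {I : Type} {s : I → G}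
    (hs : Function.Bijective fun i => (s i : G ⧸ H)) (ζ : I → σ.H) (x : G) (h : H) :
    extendSection hs ζ (x * h) = σ.act h⁻¹ (extendSection hs ζ x) := by
  have h1 : ((x * h : G) : G ⧸ H) = x := by simp
  unfold extendSection
  change _ = (σ.act h⁻¹ * σ.act _) _
  rw [← map_mul]
  congr 2
  · rw [← mul_inv_rev]
    congr 1
    apply Subtype.ext
    simp [h1, mul_assoc]
  · rw [h1]

theorem extendSection_apply {I : Type} {s : I → G}
    (hs : Function.Bijective fun i => (s i : G ⧸ H)) (ζ : I → σ.H) (i : I) :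
    extendSection hs ζ (s i) = ζ i := by
  have h1 : (Equiv.ofBijective _ hs).symm (s i : G ⧸ H) = i :=
    (Equiv.ofBijective _ hs).symm_apply_apply i
  have h2 : ∀ (j : I) (hj : (s j)⁻¹ * s i ∈ H), j = i →
      σ.act (⟨(s j)⁻¹ * s i, hj⟩ : H)⁻¹ (ζ j) = ζ i := by
    rintro j hj rfl
    have : (⟨(s j)⁻¹ * s j, hj⟩ : H) = 1 := by ext; simp
    rw [this]
    simp
  exact h2 _ _ h1

/-- Restriction of an equivariant function to a system of representatives of `G / H`. -/
def evalSection (σ : UnitaryRep H) {I : Type} {s : I → G}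
    (hs : Function.Bijective fun i => (s i : G ⧸ H)) :
    IndSpace σ ≃ₗ[ℂ] lp (fun _ : I => σ.H) 2 where
  toFun f := ⟨fun i => f (s i), (memlp_section_iff f.2.1 hs).2 f.2.2⟩
  map_add' f g := rfl
  map_smul' c f := rfl
  invFun ζ := ⟨extendSection hs ζ, extendSection_mul hs ζ, by
    rw [← memlp_section_iff (extendSection_mul hs _) hs]
    simp only [extendSection_apply]
    exact ζ.2⟩
  left_inv f := by
    apply IndSpace.ext
    intro x
    change extendSection hs (fun i => f (s i)) x = f x
    obtain ⟨i, hi⟩ := hs.2 (x : G ⧸ H)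
    obtain ⟨h, rfl⟩ : ∃ h : H, x = s i * h :=
      ⟨⟨(s i)⁻¹ * x, QuotientGroup.eq.1 hi⟩, by simp⟩
    rw [extendSection_mul, extendSection_apply, f.map_mul]
  right_inv ζ := by
    ext i
    exact extendSection_apply hs ζ i

theorem out_bijective : Function.Bijective fun q : G ⧸ H => ((q.out : G) : G ⧸ H) := by
  have : (fun q : G ⧸ H => ((q.out : G) : G ⧸ H)) = id := funext fun q => Quotient.out_eq' q
  rw [this]
  exact Function.bijective_id

variable (σ) in
/-- Values on the chosen coset representatives. -/
def evalOut : IndSpace σ ≃ₗ[ℂ] lp (fun _ : G ⧸ H => σ.H) 2 := evalSection σ out_bijective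

instance : NormedAddCommGroup (IndSpace σ) :=
  NormedAddCommGroup.induced _ _ (evalOut σ) (evalOut σ).injective

instance : InnerProductSpace ℂ (IndSpace σ) := InnerProductSpace.induced (evalOut σ)

theorem IndSpace.inner_eq (f g : IndSpace σ) :
    inner ℂ f g = ∑' q : G ⧸ H, inner ℂ (f q.out) (g q.out) := rfl

theorem norm_evalSection {I : Type} {s : I → G}
    (hs : Function.Bijective fun i => (s i : G ⧸ H)) (f : IndSpace σ) :
    ‖evalSection σ hs f‖ = ‖f‖ := by
  have h0 : 0 < (2 : ℝ≥0∞).toReal := by norm_num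
  change _ = ‖evalOut σ f‖
  rw [lp.norm_eq_tsum_rpow h0, lp.norm_eq_tsum_rpow h0,
    ← (Equiv.ofBijective _ hs).tsum_eq]
  congr 1
  refine tsum_congr fun i => ?_
  congr 1
  exact norm_eq_of_equivariant f.2.1 (Quotient.out_eq' _).symm

/-- Restriction to a system of representatives `s` of `G / H` as a unitary operator onto `ℓ²`. -/
def sectionIsometry (σ : UnitaryRep H) {I : Type} {s : I → G}
    (hs : Function.Bijective fun i => (s i : G ⧸ H)) :
    IndSpace σ ≃ₗᵢ[ℂ] lp (fun _ : I => σ.H) 2 where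
  toLinearEquiv := evalSection σ hs
  norm_map' := norm_evalSection hs

instance : CompleteSpace (IndSpace σ) :=
  (sectionIsometry σ (out_bijective (H := H))).toIsometryEquiv.completeSpace

theorem translate_bijective (g : G) {I : Type} {s : I → G}
    (hs : Function.Bijective fun i => (s i : G ⧸ H)) :
    Function.Bijective fun i => ((g * s i : G) : G ⧸ H) :=
  (MulAction.bijective (β := G ⧸ H) g).comp hs

/-- Left translation `f ↦ f (g⁻¹ ·)` on the space of the induced representation. -/
def translate (g : G) (f : IndSpace σ) : IndSpace σ :=
  ⟨fun x => f (g⁻¹ * x), fun x h => by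
    change f (g⁻¹ * (x * h)) = _
    rw [← mul_assoc, f.map_mul], by
    have h1 := translate_bijective g⁻¹ (out_bijective (H := H))
    exact (memlp_section_iff f.2.1 h1).2 f.2.2⟩

theorem translate_apply (g x : G) (f : IndSpace σ) : translate g f x = f (g⁻¹ * x) := rfl

theorem translate_one (f : IndSpace σ) : translate 1 f = f :=
  IndSpace.ext fun x => by rw [translate_apply, inv_one, one_mul]

theorem translate_mul (g h : G) (f : IndSpace σ) :
    translate (g * h) f = translate g (translate h f) :=
  IndSpace.ext fun x => by
    rw [translate_apply, translate_apply, translate_apply, mul_inv_rev, mul_assoc]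

theorem norm_translate (g : G) (f : IndSpace σ) : ‖translate g f‖ = ‖f‖ := by
  rw [← norm_evalSection (translate_bijective g⁻¹ (out_bijective (H := H))) f,
    ← norm_evalSection (out_bijective (H := H)) (translate g f)]
  rfl

/-- The induced representation `ind_H^G σ`, given by `(ind_H^G σ)(g) f (x) = f (g⁻¹ x)`. -/
def ind (σ : UnitaryRep H) : UnitaryRep G where
  H := IndSpace σ
  act :=
    { toFun := fun g =>
        { toFun := translate g
          invFun := translate g⁻¹
          map_add' := fun _ _ => rfl
          map_smul' := fun _ _ => rfl
          left_inv := fun f => by rw [← translate_mul, inv_mul_cancel, translate_one]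
          right_inv := fun f => by rw [← translate_mul, mul_inv_cancel, translate_one]
          norm_map' := norm_translate g }
      map_one' := LinearIsometryEquiv.ext translate_one
      map_mul' := fun g h => LinearIsometryEquiv.ext (translate_mul g h) }

end Induced

/-! ### Crystal groups -/

/-- `ℝⁿ` with its Euclidean structure. -/
abbrev E (n : ℕ) := EuclideanSpace ℝ (Fin n)

/-- The group `I(ℝⁿ)` of isometries of `ℝⁿ` (under composition). The isometry `z ↦ L (z + x)`
is written `[x, L]`. -/
abbrev Iso (n : ℕ) := E n ≃ᵃⁱ[ℝ] E n

variable {n : ℕ}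

/-- The linear part `Q [x, L] = L`. -/
def linPart : Iso n →* (E n ≃ₗᵢ[ℝ] E n) where
  toFun g := g.linearIsometryEquiv
  map_one' := rfl
  map_mul' _ _ := rfl

/-- The vector part `x` of `[x, L]`. -/
def vecPart (g : Iso n) : E n := (linPart g).symm (g 0)

theorem apply_eq (g : Iso n) (z : E n) : g z = linPart g (z + vecPart g) := by
  have h := g.map_vadd 0 z
  simp only [vadd_eq_add, add_zero] at h
  rw [h, vecPart, map_add, LinearIsometryEquiv.apply_symm_apply]
  rfl

theorem vecPart_eq_iff (g : Iso n) (x : E n) : vecPart g = x ↔ g 0 = linPart g x := by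
  rw [apply_eq, zero_add]
  exact (linPart g).injective.eq_iff.symm

theorem vecPart_one : vecPart (1 : Iso n) = 0 := by
  rw [vecPart_eq_iff]; simp

theorem vecPart_mul (g h : Iso n) :
    vecPart (g * h) = (linPart h)⁻¹ (vecPart g) + vecPart h := by
  rw [vecPart_eq_iff, map_mul, AffineIsometryEquiv.coe_mul, Function.comp_apply, apply_eq g,
    apply_eq h, zero_add]
  change linPart g _ = linPart g (linPart h _)
  congr 1
  rw [map_add, add_comm]
  congr 1
  exact ((linPart h).apply_symm_apply _).symm

theorem vecPart_inv (g : Iso n) : vecPart g⁻¹ = -linPart g (vecPart g) := by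
  have h := vecPart_mul g⁻¹ g
  rw [inv_mul_cancel, vecPart_one] at h
  have h2 := congrArg (linPart g) (eq_neg_of_add_eq_zero_left h.symm)
  rw [map_neg] at h2
  rw [← h2]
  exact ((linPart g).apply_symm_apply _).symm

/-- The translation `[x, id]`. -/
def trans (x : E n) : Iso n := AffineIsometryEquiv.constVAdd ℝ (E n) x

/-- The orbit equivalence relation of `Γ` on `ℝⁿ`. -/
def orbitSetoid (Γ : Subgroup (Iso n)) : Setoid (E n) where
  r y z := ∃ g ∈ Γ, g z = y
  iseqv :=
    { refl := fun z => ⟨1, Γ.one_mem, rfl⟩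
      symm := by
        rintro y z ⟨g, hg, rfl⟩
        exact ⟨g⁻¹, Γ.inv_mem hg, g.symm_apply_apply z⟩
      trans := by
        rintro x y z ⟨g, hg, rfl⟩ ⟨h, hh, rfl⟩
        exact ⟨g * h, Γ.mul_mem hg hh, rfl⟩ }

/-- The topology on `I(ℝⁿ)` inherited from the compact-open topology on `C(ℝⁿ, ℝⁿ)`. -/
instance : TopologicalSpace (Iso n) :=
  TopologicalSpace.induced (fun g => (⟨g, g.continuous⟩ : C(E n, E n))) inferInstance

/-- A crystal group: a discrete subgroup of `I(ℝⁿ)` with compact orbit space. -/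
structure IsCrystalGroup (Γ : Subgroup (Iso n)) : Prop where
  discrete : DiscreteTopology Γ
  cocompact : CompactSpace (Quotient (orbitSetoid Γ))

/-- The point group `Π = Q(Γ)`. -/
def pointGroup (Γ : Subgroup (Iso n)) : Subgroup (E n ≃ₗᵢ[ℝ] E n) := Γ.map linPart

/-- The restriction of `Q` to `Γ`, as a homomorphism onto the point group. -/
def toPoint (Γ : Subgroup (Iso n)) : Γ →* pointGroup Γ where
  toFun g := ⟨linPart g, g, g.2, rfl⟩
  map_one' := rfl
  map_mul' _ _ := rfl

/-- The translation subgroup `T` of `Γ`, as a subgroup of `Γ`. -/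
def T (Γ : Subgroup (Iso n)) : Subgroup Γ := (toPoint Γ).ker

instance (Γ : Subgroup (Iso n)) : (T Γ).Normal := inferInstanceAs (toPoint Γ).ker.Normal

theorem mem_T_iff {Γ : Subgroup (Iso n)} {g : Γ} : g ∈ T Γ ↔ linPart (g : Iso n) = 1 := by
  rw [T, MonoidHom.mem_ker, Subtype.ext_iff]
  rfl

theorem vecPart_mul_T {Γ : Subgroup (Iso n)} (s t : T Γ) :
    vecPart ((s * t : T Γ) : Γ).1 = vecPart (s : Γ).1 + vecPart (t : Γ).1 := by
  have h : linPart (t : Γ).1 = 1 := mem_T_iff.1 t.2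
  change vecPart ((s : Γ).1 * (t : Γ).1) = _
  rw [vecPart_mul, h, inv_one, LinearIsometryEquiv.coe_one, id]

theorem T_comm {Γ : Subgroup (Iso n)} (s t : T Γ) : s * t = t * s := by
  apply Subtype.ext
  apply Subtype.ext
  ext1 z
  have hs : linPart ((s * t : T Γ) : Γ).1 = 1 := mem_T_iff.1 (s * t).2
  have ht : linPart ((t * s : T Γ) : Γ).1 = 1 := mem_T_iff.1 (t * s).2
  rw [apply_eq, apply_eq, hs, ht, vecPart_mul_T, vecPart_mul_T, add_comm (vecPart (s : Γ).1)]

/-- The Bravais lattice `ℒ = {x | [x, id] ∈ Γ}`. -/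
def bravais (Γ : Subgroup (Iso n)) : AddSubgroup (E n) where
  carrier := {x | trans x ∈ Γ}
  zero_mem' := by
    have : trans (0 : E n) = 1 := by ext1 z; simp [trans]
    simp only [Set.mem_ofPred_eq, this, Γ.one_mem]
  add_mem' := by
    intro x y hx hy
    have : trans (x + y) = trans x * trans y := by ext1 z; simp [trans, add_assoc]
    simp only [Set.mem_ofPred_eq, this] at *
    exact Γ.mul_mem hx hy
  neg_mem' := by
    intro x hx
    have : trans (-x) = (trans x)⁻¹ := by
      rw [eq_inv_iff_mul_eq_one]; ext1 z; simp [trans]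
    simp only [Set.mem_ofPred_eq, this] at *
    exact Γ.inv_mem hx

/-- The dual lattice `ℒ* = {z | x · z ∈ ℤ for all x ∈ ℒ}`. -/
def dualLattice (Γ : Subgroup (Iso n)) : AddSubgroup (E n) where
  carrier := {z | ∀ x ∈ bravais Γ, ∃ m : ℤ, inner ℝ x z = m}
  zero_mem' := fun x _ => ⟨0, by simp⟩
  add_mem' := by
    intro y z hy hz x hx
    obtain ⟨a, ha⟩ := hy x hx
    obtain ⟨b, hb⟩ := hz x hx
    exact ⟨a + b, by rw [inner_add_right, ha, hb]; push_cast; rfl⟩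
  neg_mem' := by
    intro z hz x hx
    obtain ⟨a, ha⟩ := hz x hx
    exact ⟨-a, by rw [inner_neg_right, ha]; push_cast; rfl⟩

theorem bravais_pointGroup {Γ : Subgroup (Iso n)} {L : E n ≃ₗᵢ[ℝ] E n} (hL : L ∈ pointGroup Γ)
    {x : E n} (hx : x ∈ bravais Γ) : L x ∈ bravais Γ := by
  obtain ⟨g, hg, rfl⟩ := hL
  have : trans (linPart g x) = g * trans x * g⁻¹ := by
    rw [eq_mul_inv_iff_mul_eq]
    ext1 z
    exact (g.map_vadd z x).symm
  change trans _ ∈ Γ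
  rw [this]
  exact Γ.mul_mem (Γ.mul_mem hg hx) (Γ.inv_mem hg)

theorem dualLattice_pointGroup {Γ : Subgroup (Iso n)} {L : E n ≃ₗᵢ[ℝ] E n}
    (hL : L ∈ pointGroup Γ) {z : E n} (hz : z ∈ dualLattice Γ) : L z ∈ dualLattice Γ := by
  intro x hx
  obtain ⟨m, hm⟩ := hz _ (bravais_pointGroup (inv_mem hL) hx)
  refine ⟨m, ?_⟩
  rw [← hm, ← L.inner_map_map (L⁻¹ x) z]
  congr 1
  exact (L.apply_symm_apply x).symm

/-- The dual crystal group `Γ* = {[z, L] | z ∈ ℒ*, L ∈ Π}`. -/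
def dualGroup (Γ : Subgroup (Iso n)) : Subgroup (Iso n) where
  carrier := {g | vecPart g ∈ dualLattice Γ ∧ linPart g ∈ pointGroup Γ}
  one_mem' := ⟨by rw [vecPart_one]; exact zero_mem _, by rw [map_one]; exact one_mem _⟩
  mul_mem' := by
    rintro g h ⟨hg, hg'⟩ ⟨hh, hh'⟩
    refine ⟨?_, by rw [map_mul]; exact mul_mem hg' hh'⟩
    rw [vecPart_mul]
    exact add_mem (dualLattice_pointGroup (inv_mem hh') hg) hh
  inv_mem' := by
    rintro g ⟨hg, hg'⟩
    refine ⟨?_, by rw [map_inv]; exact inv_mem hg'⟩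
    rw [vecPart_inv]
    exact neg_mem (dualLattice_pointGroup hg' hg)

/-- The group `T*` of translations in `Γ*`. -/
def dualTranslations (Γ : Subgroup (Iso n)) : Subgroup (Iso n) := dualGroup Γ ⊓ linPart.ker

/-! ### Fundamental domains, fundamental sets, transversals -/

/-- The Dirichlet domain `D(a)` of the group `Δ` with centre `a`. -/
def dirichletDomain (Δ : Subgroup (Iso n)) (a : E n) : Set (E n) :=
  {y | ∀ g ∈ Δ, g ≠ 1 → dist y a < dist y (g a)}

/-- `S` is a fundamental set for `Δ`: it meets each orbit in exactly one point. -/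
def IsFundamentalSet (Δ : Subgroup (Iso n)) (S : Set (E n)) : Prop :=
  ∀ x : E n, ∃! y : E n, y ∈ S ∧ ∃ g ∈ Δ, g x = y

/-- `Π X = ⋃_{L ∈ Π} L X`. -/
def pointSaturation (Γ : Subgroup (Iso n)) (X : Set (E n)) : Set (E n) :=
  ⋃ L ∈ pointGroup Γ, L '' X

/-- `Ω_{T*}` is a fundamental set for `T*` with `Π R ⊆ Ω_{T*} ⊆ Π (closure R)`. -/
structure IsParameterDomain (Γ : Subgroup (Iso n)) (R ΩT : Set (E n)) : Prop where
  fundamental : IsFundamentalSet (dualTranslations Γ) ΩT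
  lower : pointSaturation Γ R ⊆ ΩT
  upper : ΩT ⊆ pointSaturation Γ (closure R)

/-- The action of `L ∈ Π` on `Ω_{T*}`: the point `ω` is sent to the representative in `Ω_{T*}`
of the `T*`-orbit `Lω + ℒ*` of `Lω`. -/
def paramAct {Γ : Subgroup (Iso n)} {ΩT : Set (E n)}
    (h : IsFundamentalSet (dualTranslations Γ) ΩT) (L : pointGroup Γ) (ω : E n) : E n :=
  (h ((L : E n ≃ₗᵢ[ℝ] E n) ω)).choose

/-- `Ω` is a transversal, with `R ⊆ Ω ⊆ closure R`, for the action of `Π` on `Ω_{T*}`. -/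
structure IsDualTransversal {Γ : Subgroup (Iso n)} {R ΩT : Set (E n)}
    (h : IsParameterDomain Γ R ΩT) (Ω : Set (E n)) : Prop where
  subset : Ω ⊆ ΩT
  meets : ∀ ν ∈ ΩT, ∃! ω, ω ∈ Ω ∧ ∃ L : pointGroup Γ, paramAct h.fundamental L ν = ω
  lower : R ⊆ Ω
  upper : Ω ⊆ closure R

/-! ### Characters of `T`, stabilizers, and the representations `U^χ` -/

/-- The character `χ_ω^T ([y, id]) = exp (2πi ω · y)` of `T`. -/
def chiT (Γ : Subgroup (Iso n)) (ω : E n) : T Γ →* Circle where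
  toFun t := Real.fourierChar (inner ℝ ω (vecPart (t : Γ).1))
  map_one' := by
    have : vecPart ((1 : T Γ) : Γ).1 = 0 := vecPart_one
    rw [this, inner_zero_right, AddChar.map_zero_eq_one]
  map_mul' s t := by rw [vecPart_mul_T, inner_add_right, AddChar.map_add_eq_mul]

/-- The conjugation action of `Γ` on characters of `T`: `(g · χ)(t) = χ (g⁻¹ t g)`. -/
def conjChar {Γ : Subgroup (Iso n)} (g : Γ) (χ : T Γ →* Circle) : T Γ →* Circle :=
  χ.comp (MulAut.conjNormal g⁻¹ : MulAut (T Γ)).toMonoidHom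

/-- The stabilizer `Γ_χ` of a character `χ` of `T`. -/
def stab {Γ : Subgroup (Iso n)} (χ : T Γ →* Circle) : Subgroup Γ where
  carrier := {g | conjChar g χ = χ}
  one_mem' := by ext t; simp [conjChar]
  mul_mem' := by
    intro g h hg hh
    have : conjChar (g * h) χ = conjChar g (conjChar h χ) := by ext t; simp [conjChar]
    simp only [Set.mem_ofPred_eq] at *
    rw [this, hh, hg]
  inv_mem' := by
    intro g hg
    have : conjChar g⁻¹ (conjChar g χ) = χ := by ext t; simp [conjChar]
    simp only [Set.mem_ofPred_eq] at *
    rwa [hg] at this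

theorem T_le_stab {Γ : Subgroup (Iso n)} (χ : T Γ →* Circle) : T Γ ≤ stab χ := by
  intro s hs
  change conjChar s χ = χ
  ext t
  have : (MulAut.conjNormal s⁻¹ : MulAut (T Γ)) t = t := by
    apply Subtype.ext
    have h := congrArg Subtype.val (T_comm ⟨s, hs⟩⁻¹ t)
    simp only [Subgroup.coe_mul, InvMemClass.coe_inv] at h
    rw [MulAut.conjNormal_apply, h, inv_inv, inv_mul_cancel_right]
  change ((χ ((MulAut.conjNormal s⁻¹ : MulAut (T Γ)) t) : Circle) : ℂ) = _
  rw [this]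

/-- The classes of irreducible representations of `Γ_χ` whose restriction to `T` is a multiple
of `χ`. -/
def dualOver {Γ : Subgroup (Iso n)} (χ : T Γ →* Circle) : Set (RepClass (stab χ)) :=
  {c | ∃ σ : UnitaryRep (stab χ), σ.IsIrreducible ∧
    (σ.restrict (Subgroup.inclusion (T_le_stab χ))).IsMultipleOf (UnitaryRep.ofCharacter χ) ∧
    c = repClass σ}

/-- A cross-section `γ : Π → Γ` of `Q` with `γ(id) = [0, id]`. -/
structure CrossSection (Γ : Subgroup (Iso n)) where
  /-- the underlying map -/
  toFun : pointGroup Γ → Γ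
  isSection : ∀ L, toPoint Γ (toFun L) = L
  map_one : toFun 1 = 1

theorem CrossSection.bijective {Γ : Subgroup (Iso n)} (γ : CrossSection Γ) :
    Function.Bijective fun L => (γ.toFun L : Γ ⧸ T Γ) := by
  constructor
  · intro L M h
    have h1 : toPoint Γ ((γ.toFun L)⁻¹ * γ.toFun M) = 1 := QuotientGroup.eq.1 h
    rw [map_mul, map_inv, γ.isSection, γ.isSection] at h1
    exact inv_mul_eq_one.1 h1
  · intro q
    obtain ⟨g, rfl⟩ := QuotientGroup.mk_surjective q
    refine ⟨toPoint Γ g, QuotientGroup.eq.2 ?_⟩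
    change toPoint Γ _ = 1
    rw [map_mul, map_inv, γ.isSection, inv_mul_cancel]

/-- The unitary `W : f ↦ f ∘ γ` from the space of `ind_T^Γ χ` onto `ℓ²(Π)`. -/
def W {Γ : Subgroup (Iso n)} (γ : CrossSection Γ) (χ : T Γ →* Circle) :
    IndSpace (UnitaryRep.ofCharacter χ) ≃ₗᵢ[ℂ] lp (fun _ : pointGroup Γ => ℂ) 2 :=
  sectionIsometry (UnitaryRep.ofCharacter χ) γ.bijective

/-- The representation `U^χ = W (ind_T^Γ χ) W⁻¹` of `Γ` on `ℓ²(Π)`. -/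
def U {Γ : Subgroup (Iso n)} (γ : CrossSection Γ) (χ : T Γ →* Circle) : UnitaryRep Γ :=
  (ind (UnitaryRep.ofCharacter χ)).transport (W γ χ)

end Crystal

end

/-! This is Mackey's little group method for the abelian normal subgroup `T` of finite index in `Γ`,
combined with Bieberbach's first theorem.

Geometry. Bieberbach's theorem says that the point group is finite and that `ℒ` is a lattice
spanning `ℝⁿ`. It is proved by Buser's argument: an element of `Γ` whose linear part is within `1/2`
of the identity is a translation (`linPart_eq_one_of_norm_le`). Consequently `T` is finitely
generated of finite index, every character of `T` is some `χ_ω`, and `χ_ω = χ_ω'` exactly when `ω -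
ω' ∈ ℒ*`. An element of `Γ` with linear part `L` carries `χ_ω` to `χ_{Lω}`, so the `Γ`-orbits of
characters are the `Γ*`-orbits of points, and `Ω` meets each of them. A point of the Dirichlet
domain `R` has trivial stabilizer in `Γ*`, hence `Γ_ω = T` there. The set `Ω \ R` lies in a
countable union of bisecting hyperplanes, hence is null.

Representations. An irreducible `π` contains a character of `T` (`IsIrreducible.exists_character`).
No finite dimensionality is assumed: by Schur's lemma the coefficients of the orbit polynomial of `t
∈ T` act as scalars, so `π(t)` is algebraic, and finitely many commuting algebraic operators have a
common eigenvector. Translating that eigenvector by `Γ` moves the character to some `χ_ω` with `ω ∈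
Ω`. By Clifford theory `π` is induced from the `χ_ω`-isotypic subspace, a representation of `Γ_ω`
(`exists_equivalent_ind`); when `Γ_ω = T`, one unit vector in it suffices and `π` is induced from
`χ_ω` itself (`equivalent_ind_ofCharacter`). Conversely, Mackey's criterion `ind_isIrreducible`
shows that all the induced representations listed are irreducible. -/

noncomputable section

namespace Crystal

/-! ### Schur's lemma for unitary representations on Hilbert space. -/

namespace UnitaryRep

variable {G : Type} [Group G]

/-- The operator `π(g)` as a bounded operator. -/
def op (π : UnitaryRep G) (g : G) : π.H →L[ℂ] π.H :=
  (π.act g).toContinuousLinearEquiv.toContinuousLinearMap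

@[simp]
theorem op_apply (π : UnitaryRep G) (g : G) (v : π.H) : π.op g v = π.act g v := rfl

theorem act_mul_apply (π : UnitaryRep G) (g h : G) (v : π.H) :
    π.act (g * h) v = π.act g (π.act h v) := by
  rw [map_mul]; rfl

theorem act_one_apply (π : UnitaryRep G) (v : π.H) : π.act 1 v = v := by
  rw [map_one]; rfl

theorem act_inv_act (π : UnitaryRep G) (g : G) (v : π.H) : π.act g⁻¹ (π.act g v) = v := by
  rw [← act_mul_apply, inv_mul_cancel, act_one_apply]

theorem act_act_inv (π : UnitaryRep G) (g : G) (v : π.H) : π.act g (π.act g⁻¹ v) = v := by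
  rw [← act_mul_apply, mul_inv_cancel, act_one_apply]

theorem inner_act_left (π : UnitaryRep G) (g : G) (v w : π.H) :
    inner ℂ (π.act g v) w = inner ℂ v (π.act g⁻¹ w) := by
  rw [← (π.act g).inner_map_map v, act_act_inv]

theorem inner_act_right (π : UnitaryRep G) (g : G) (v w : π.H) :
    inner ℂ v (π.act g w) = inner ℂ (π.act g⁻¹ v) w := by
  rw [← (π.act g).inner_map_map _ w, act_act_inv]

theorem op_mul (π : UnitaryRep G) (g h : G) : π.op (g * h) = π.op g * π.op h := by
  ext v; exact π.act_mul_apply g h v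

theorem op_one (π : UnitaryRep G) : π.op 1 = 1 := by
  ext v; exact π.act_one_apply v

theorem star_op (π : UnitaryRep G) (g : G) : star (π.op g) = π.op g⁻¹ := by
  rw [ContinuousLinearMap.star_eq_adjoint, eq_comm, ContinuousLinearMap.eq_adjoint_iff]
  intro x y
  simp [inner_act_right]

/-- Schur's lemma for self-adjoint operators. -/
theorem IsIrreducible.exists_eq_algebraMap_of_isSelfAdjoint {π : UnitaryRep G}
    (hπ : π.IsIrreducible) {a : π.H →L[ℂ] π.H} (hsa : IsSelfAdjoint a)
    (ha : ∀ g, Commute a (π.op g)) : ∃ r : ℝ, a = algebraMap ℝ _ r := by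
  obtain ⟨hnt, hirr⟩ := hπ
  by_cases hs : (spectrum ℝ a).Subsingleton
  · obtain h | ⟨r, h⟩ := hs.eq_empty_or_singleton
    · exact ⟨0, CFC.eq_algebraMap_of_spectrum_subset_singleton a 0 (by simp [h])⟩
    · exact ⟨r, CFC.eq_algebraMap_of_spectrum_subset_singleton a r h.le⟩
  exfalso
  rw [Set.not_subsingleton_iff] at hs
  obtain ⟨x, hx, y, hy, hxy⟩ := hs.exists_lt
  -- Two points of the spectrum are separated by their midpoint `m`. The functions `f` and `h` live
  -- on opposite sides of `m`, so `f(a)` and `h(a)` are nonzero with product zero, and the kernel of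
  -- `f(a)` is a closed invariant subspace that is neither zero nor everything.
  set m := (x + y) / 2
  let f : ℝ → ℝ := fun s => max 0 (m - s)
  let h : ℝ → ℝ := fun s => max 0 (s - m)
  have hf : Continuous f := by fun_prop
  have hh : Continuous h := by fun_prop
  have hne : ∀ (k : ℝ → ℝ), Continuous k → ∀ s ∈ spectrum ℝ a, k s ≠ 0 → cfc k a ≠ 0 := by
    intro k hk s hs hks h0
    have := cfc_map_spectrum k a (ha := hsa) (hf := hk.continuousOn)
    rw [h0, spectrum.zero_eq] at this
    exact hks (by simpa using this.ge ⟨s, hs, rfl⟩)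
  have hf0 : cfc f a ≠ 0 := hne f hf x hx (by
    have : 0 < m - x := by simp only [m]; linarith
    simp only [f]; rw [max_eq_right this.le]; exact this.ne')
  have hh0 : cfc h a ≠ 0 := hne h hh y hy (by
    have : 0 < y - m := by simp only [m]; linarith
    simp only [h]; rw [max_eq_right this.le]; exact this.ne')
  have hfh : cfc f a * cfc h a = 0 := by
    rw [← cfc_mul f h a hf.continuousOn hh.continuousOn, ← cfc_zero (R := ℝ) a]
    congr 1
    ext s
    simp only [f, h, Pi.zero_apply, mul_eq_zero]
    rcases le_total s m with hsm | hsm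
    · right; exact max_eq_left (by linarith)
    · left; exact max_eq_left (by linarith)
  rcases hirr (LinearMap.ker (cfc f a).toLinearMap) (cfc f a).isClosed_ker (by
    intro g v hv
    have hc : Commute (cfc f a) (π.op g) := (ha g).cfc_real f
    have := DFunLike.congr_fun hc.eq v
    simp only [mul_apply_eq_comp, op_apply] at this
    simp only [LinearMap.mem_ker, ContinuousLinearMap.coe_coe] at hv ⊢
    rw [this, hv, map_zero]) with hK | hK
  · apply hh0
    ext v
    have hv : cfc h a v ∈ LinearMap.ker (cfc f a).toLinearMap := by
      simpa using DFunLike.congr_fun hfh v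
    rw [hK] at hv
    simpa using hv
  · apply hf0
    ext v
    have hv : v ∈ LinearMap.ker (cfc f a).toLinearMap := by rw [hK]; trivial
    simpa using hv

/-- Schur's lemma: the commutant of an irreducible unitary representation is `ℂ`. -/
theorem IsIrreducible.exists_eq_algebraMap {π : UnitaryRep G} (hπ : π.IsIrreducible)
    {a : π.H →L[ℂ] π.H} (ha : ∀ g, Commute a (π.op g)) : ∃ c : ℂ, a = algebraMap ℂ _ c := by
  have hstar : ∀ g, Commute (star a) (π.op g) := by
    intro g
    have := (ha g⁻¹).star_star
    rwa [star_op, inv_inv] at this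
  obtain ⟨r, hr⟩ := hπ.exists_eq_algebraMap_of_isSelfAdjoint (realPart a).2
    (fun g => by
      rw [realPart_apply_coe]
      exact ((ha g).add_left (hstar g)).smul_left _)
  obtain ⟨s, hs⟩ := hπ.exists_eq_algebraMap_of_isSelfAdjoint (imaginaryPart a).2
    (fun g => by
      rw [imaginaryPart_apply_coe]
      exact (((ha g).sub_left (hstar g)).smul_left _).smul_left _)
  refine ⟨r + Complex.I * s, ?_⟩
  rw [← realPart_add_I_smul_imaginaryPart a, hr, hs]
  ext v
  simp [Algebra.algebraMap_eq_smul_one, add_smul, mul_smul]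

end UnitaryRep

/-! ### Existence of a character: algebraic operators and common eigenvectors. -/

/-- If a nonzero polynomial in `f` annihilates `v ≠ 0`, then some polynomial in `f` maps `v` to an
eigenvector of `f`. -/
theorem exists_aeval_eigenvector {V : Type*} [AddCommGroup V] [Module ℂ V] (f : Module.End ℂ V)
    {v : V} (hv : v ≠ 0) {q : Polynomial ℂ} (hq : q ≠ 0) (hqv : Polynomial.aeval f q v = 0) :
    ∃ (r : Polynomial ℂ) (c : ℂ), Polynomial.aeval f r v ≠ 0 ∧
      f (Polynomial.aeval f r v) = c • Polynomial.aeval f r v := by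
  induction hd : q.natDegree using Nat.strong_induction_on generalizing q with
  | _ d ih =>
    have hdeg : q.degree ≠ 0 := by
      intro h0
      rw [Polynomial.eq_C_of_degree_eq_zero h0] at hqv hq
      simp only [Polynomial.aeval_C, Module.algebraMap_end_apply, smul_eq_zero] at hqv
      exact hq (by rw [hqv.resolve_right hv, map_zero])
    obtain ⟨c, hc⟩ := Complex.exists_root (f := q) (by
      rw [← Polynomial.natDegree_pos_iff_degree_pos, Polynomial.natDegree_pos_iff_degree_pos]
      exact lt_of_le_of_ne (by rw [Polynomial.degree_eq_natDegree hq]; positivity) hdeg.symm)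
    obtain ⟨r, rfl⟩ := Polynomial.dvd_iff_isRoot.2 hc
    have hr : r ≠ 0 := right_ne_zero_of_mul hq
    by_cases h : Polynomial.aeval f r v = 0
    · exact ih r.natDegree (by
        rw [← hd, Polynomial.natDegree_mul (Polynomial.X_sub_C_ne_zero c) hr,
          Polynomial.natDegree_X_sub_C]; omega) hr h rfl
    · refine ⟨r, c, h, ?_⟩
      rw [map_mul] at hqv
      simpa [sub_eq_zero] using hqv

/-- Finitely many commuting operators, each annihilated by a nonzero polynomial, have a common
eigenvector. -/
theorem exists_common_eigenvector {V ι : Type*} [AddCommGroup V] [Module ℂ V] [Nontrivial V]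
    (f : ι → Module.End ℂ V) (hf : ∀ i j, Commute (f i) (f j))
    (hq : ∀ i, ∃ q : Polynomial ℂ, q ≠ 0 ∧ Polynomial.aeval (f i) q = 0) (s : Finset ι) :
    ∃ v : V, v ≠ 0 ∧ ∀ i ∈ s, ∃ c : ℂ, f i v = c • v := by
  classical
  induction s using Finset.induction_on with
  | empty => obtain ⟨v, hv⟩ := exists_ne (0 : V); exact ⟨v, hv, by simp⟩
  | insert j s _ ih =>
    obtain ⟨v, hv, h⟩ := ih
    obtain ⟨q, hq0, hq⟩ := hq j
    obtain ⟨r, c, hr, hc⟩ := exists_aeval_eigenvector (f j) hv hq0 (by rw [hq]; rfl)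
    refine ⟨_, hr, fun i hi => ?_⟩
    obtain rfl | hi := Finset.mem_insert.1 hi
    · exact ⟨c, hc⟩
    · obtain ⟨b, hb⟩ := h i hi
      refine ⟨b, ?_⟩
      -- The new vector is a polynomial in `f j` applied to the old one, and such a polynomial
      -- commutes with every `f i`, so the eigenvalues already obtained persist.
      have hcomm : Commute (f i) (Polynomial.aeval (f j) r) := by
        refine Polynomial.induction_on' r (fun p q hp hq => ?_) (fun n a => ?_)
        · rw [map_add]; exact hp.add_right hq
        · rw [Polynomial.aeval_monomial]
          exact (Algebra.commute_algebraMap_right a (f i)).mul_right ((hf i j).pow_right n)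
      have := LinearMap.congr_fun hcomm.eq v
      simp only [Module.End.mul_apply] at this
      rw [this, hb, map_smul]

namespace UnitaryRep

variable {G : Type} [Group G]

/-- Let `N` be an abelian group mapping to `G`, on which `G` acts compatibly with conjugation.
If an element of `N` lies in a finite `G`-orbit, then in an irreducible representation of `G` it
acts by an algebraic operator. -/
theorem IsIrreducible.exists_aeval_op_eq_zero {π : UnitaryRep G} (hπ : π.IsIrreducible)
    {N Q : Type} [CommGroup N] (ι : N →* G) (c : G →* MulAut N)
    (hc : ∀ g n, ι (c g n) * g = g * ι n) [Fintype Q] [MulAction G Q] (τ : Q → N)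
    (hτ : ∀ g q, c g (τ q) = τ (g • q)) (q₀ : Q) :
    ∃ p : Polynomial ℂ, p ≠ 0 ∧ Polynomial.aeval (π.op (ι (τ q₀))) p = 0 := by
  let φ : MonoidAlgebra ℂ N →ₐ[ℂ] (π.H →L[ℂ] π.H) := MonoidAlgebra.lift ℂ _ N
    { toFun := fun n => π.op (ι n)
      map_one' := by rw [map_one, op_one]
      map_mul' := fun m n => by rw [map_mul, op_mul] }
  have hφ : ∀ n, φ (MonoidAlgebra.of ℂ N n) = π.op (ι n) := fun n => by
    simp only [φ, MonoidAlgebra.lift_of]; rfl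
  let α : G → MonoidAlgebra ℂ N →ₐ[ℂ] MonoidAlgebra ℂ N := fun g =>
    MonoidAlgebra.mapDomainAlgHom ℂ ℂ (c g).toMonoidHom
  have hα : ∀ g n, α g (MonoidAlgebra.of ℂ N n) = MonoidAlgebra.of ℂ N (c g n) := by
    intro g n
    simp [α, MonoidAlgebra.of_apply]
  have hφα : ∀ g x, φ (α g x) * π.op g = π.op g * φ x := by
    intro g x
    induction x using MonoidAlgebra.induction_on with
    | of n => rw [hα, hφ, hφ, ← op_mul, ← op_mul, hc]
    | add x y hx hy => rw [map_add, map_add, map_add, add_mul, mul_add, hx, hy]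
    | smul r x hx => rw [map_smul, map_smul, map_smul, smul_mul_assoc, mul_smul_comm, hx]
  -- The orbit polynomial, over the commutative group algebra of `N`. As `G` permutes its roots, its
  -- coefficients are `G`-invariant, so their images under `φ` commute with `π` and are scalars by
  -- Schur's lemma.
  let P : Polynomial (MonoidAlgebra ℂ N) :=
    ∏ q, (Polynomial.X - Polynomial.C (MonoidAlgebra.of ℂ N (τ q)))
  have hP : ∀ g, P.map (α g).toRingHom = P := by
    intro g
    simp only [P, Polynomial.map_prod, Polynomial.map_sub, Polynomial.map_X, Polynomial.map_C]
    conv_rhs => rw [← Equiv.prod_comp (MulAction.toPerm g)]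
    refine Finset.prod_congr rfl fun q _ => ?_
    congr 2
    exact (hα g (τ q)).trans (by rw [hτ]; rfl)
  have hcoeff : ∀ i, ∃ z : ℂ, φ (P.coeff i) = algebraMap ℂ _ z := fun i =>
    hπ.exists_eq_algebraMap fun g => by
      have h1 := hφα g (P.coeff i)
      have h2 : α g (P.coeff i) = P.coeff i := by
        conv_rhs => rw [← hP g, Polynomial.coeff_map]
        rfl
      rwa [h2] at h1
  choose z hz using hcoeff
  have hmonic : P.Monic := Polynomial.monic_prod_of_monic _ _ fun q _ => Polynomial.monic_X_sub_C _
  have hroot : P.eval (MonoidAlgebra.of ℂ N (τ q₀)) = 0 := by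
    rw [Polynomial.eval_prod]
    exact Finset.prod_eq_zero (Finset.mem_univ q₀) (by simp)
  have := hπ.1
  -- The witness has the scalars `z i` as coefficients. It is nonzero because `P` is monic and the
  -- identity operator is not zero.
  refine ⟨∑ i ∈ Finset.range (P.natDegree + 1), Polynomial.monomial i (z i), fun h0 => ?_, ?_⟩
  · have h1 := congrArg (fun p => Polynomial.coeff p P.natDegree) h0
    simp only [Polynomial.finsetSum_coeff, Polynomial.coeff_monomial, Polynomial.coeff_zero,
      Finset.sum_ite_eq', Finset.mem_range, Nat.lt_succ_self, if_true] at h1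
    have h2 := hz P.natDegree
    rw [h1, hmonic.coeff_natDegree, map_one, map_zero] at h2
    exact one_ne_zero h2
  · rw [map_sum, ← map_zero φ, ← hroot, Polynomial.eval_eq_sum_range, map_sum]
    refine Finset.sum_congr rfl fun i _ => ?_
    rw [Polynomial.aeval_monomial, map_mul, map_pow, hφ, hz]

/-- If a normal abelian subgroup of finite index is finitely generated, then its restriction to an
irreducible representation contains a character. -/
theorem IsIrreducible.exists_character {π : UnitaryRep G} (hπ : π.IsIrreducible)
    (N : Subgroup G) [N.Normal] [Finite (G ⧸ N)] [Group.FG N] (hN : ∀ s t : N, s * t = t * s) :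
    ∃ (χ : N →* Circle) (v : π.H), v ≠ 0 ∧ ∀ t : N, π.act t v = (χ t : ℂ) • v := by
  let _ : CommGroup N := { (inferInstance : Group N) with mul_comm := hN }
  have := Fintype.ofFinite (G ⧸ N)
  have hnt := hπ.1
  have halg : ∀ t : N, ∃ p : Polynomial ℂ, p ≠ 0 ∧ Polynomial.aeval (π.op t) p = 0 := by
    intro t
    have hconj : ∀ n : N, MulAut.conjNormal (n : G) t = t := fun n => Subtype.ext <| by
      rw [MulAut.conjNormal_apply, mul_inv_eq_iff_eq_mul]
      exact congrArg Subtype.val (hN n t)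
    -- Since `N` is abelian, the conjugate of `t` by `g` depends only on the coset of `g`; so the
    -- conjugates of `t` are indexed by the finite set `G ⧸ N`.
    have key : ∀ (g : G) (h : G), (g : G ⧸ N) = h →
        (MulAut.conjNormal g : MulAut N) t = (MulAut.conjNormal h : MulAut N) t := by
      intro g h hgh
      have h1 := hconj ⟨g⁻¹ * h, QuotientGroup.eq.1 hgh⟩
      rw [map_mul, map_inv, MulAut.mul_apply, MulAut.inv_apply, MulEquiv.symm_apply_eq] at h1
      exact h1.symm
    obtain ⟨p, hp, h⟩ := hπ.exists_aeval_op_eq_zero (Q := G ⧸ N) N.subtype MulAut.conjNormal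
      (fun g n => by simp) (fun q => MulAut.conjNormal q.out t) (fun g q => by
        rw [← MulAut.mul_apply, ← map_mul]
        apply key
        rw [QuotientGroup.out_eq']
        change g • (q.out : G ⧸ N) = g • q
        rw [QuotientGroup.out_eq']) (1 : G)
    refine ⟨p, hp, ?_⟩
    rw [key _ 1 (QuotientGroup.out_eq' _), map_one] at h
    exact h
  let f : N → Module.End ℂ π.H := fun t => (π.op t : π.H →ₗ[ℂ] π.H)
  have hf : ∀ s t, Commute (f s) (f t) := by
    intro s t
    have h1 : π.op s * π.op t = π.op t * π.op s := by
      rw [← op_mul, ← op_mul]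
      exact congrArg π.op (congrArg Subtype.val (hN s t))
    exact congrArg (fun a : π.H →L[ℂ] π.H => (a : π.H →ₗ[ℂ] π.H)) h1
  obtain ⟨S, hS⟩ := Group.FG.out (G := N)
  obtain ⟨v, hv, hvS⟩ := exists_common_eigenvector f hf (fun t => by
    obtain ⟨p, hp, h⟩ := halg t
    refine ⟨p, hp, ?_⟩
    let Λ : (π.H →L[ℂ] π.H) →ₐ[ℂ] Module.End ℂ π.H :=
      { ContinuousLinearMap.toLinearMapRingHom with commutes' := fun _ => rfl }
    have h2 := congrArg Λ h
    rw [← Polynomial.aeval_algHom_apply, map_zero] at h2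
    exact h2) S
  -- The elements for which `v` is an eigenvector form a subgroup; it contains a generating set,
  -- hence is all of `N`.
  let K : Subgroup N :=
    { carrier := {t | ∃ c : ℂ, π.act t v = c • v}
      one_mem' := ⟨1, by rw [one_smul]; exact π.act_one_apply v⟩
      mul_mem' := by
        rintro s t ⟨b, hb⟩ ⟨c, hc⟩
        exact ⟨c * b, by rw [Subgroup.coe_mul, act_mul_apply, hc, map_smul, hb, mul_smul]⟩
      inv_mem' := by
        rintro t ⟨c, hc⟩
        have hc0 : c ≠ 0 := by
          rintro rfl
          rw [zero_smul] at hc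
          exact hv ((π.act t).map_eq_zero_iff.1 hc)
        refine ⟨c⁻¹, ?_⟩
        have h1 := π.act_inv_act t v
        rw [hc, map_smul] at h1
        rw [Subgroup.coe_inv, ← h1, smul_smul, inv_mul_cancel₀ hc0, one_smul, h1] }
  have hK : ∀ t : N, ∃ c : ℂ, π.act t v = c • v := by
    have : K = ⊤ := top_le_iff.1 (hS ▸ (Subgroup.closure_le K).2 fun t ht => hvS t ht)
    intro t
    have : t ∈ K := this ▸ Subgroup.mem_top t
    exact this
  choose c hc using hK
  have hinj : ∀ {x y : ℂ}, x • v = y • v → x = y := fun h => smul_left_injective ℂ hv h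
  have hcn : ∀ t, ‖c t‖ = 1 := by
    intro t
    have h1 := (π.act t).norm_map v
    rw [hc, norm_smul] at h1
    exact (mul_eq_right₀ (norm_ne_zero_iff.2 hv)).1 h1
  let d : N → Circle := fun t => ⟨c t, mem_sphere_zero_iff_norm.2 (hcn t)⟩
  have hd : ∀ t : N, π.act t v = (d t : ℂ) • v := hc
  refine ⟨{ toFun := d
            map_one' := Circle.ext <| hinj <| by
              rw [← hd, Circle.coe_one, one_smul]; exact π.act_one_apply v
            map_mul' := fun s t => Circle.ext <| hinj <| by
              rw [← hd, Circle.coe_mul, Subgroup.coe_mul, act_mul_apply, hd, map_smul, hd,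
                smul_smul, mul_comm] }, v, hv, hd⟩

end UnitaryRep

/-! ### Induced representations from finite-index subgroups and Mackey's irreducibility criterion.
-/

section Induced

variable {G : Type} [Group G] {H : Subgroup G} {σ : UnitaryRep H}

/-- Evaluation at a point as a linear map. -/
def IndSpace.evalAt (σ : UnitaryRep H) (x : G) : IndSpace σ →ₗ[ℂ] σ.H where
  toFun f := f x
  map_add' _ _ := rfl
  map_smul' _ _ := rfl

theorem IndSpace.sum_apply {I : Type} (s : Finset I) (f : I → IndSpace σ) (x : G) :
    (∑ i ∈ s, f i : IndSpace σ) x = ∑ i ∈ s, f i x :=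
  map_sum (IndSpace.evalAt σ x) f s

theorem IndSpace.apply_eq_of_coset (f g : IndSpace σ) {x y : G} (hxy : (x : G ⧸ H) = y)
    (h : f x = g x) : f y = g y := by
  have hy : y = x * (⟨x⁻¹ * y, QuotientGroup.eq.1 hxy⟩ : H) := by simp
  rw [hy, f.map_mul, g.map_mul, h]

theorem IndSpace.ext_out {f g : IndSpace σ} (h : ∀ q : G ⧸ H, f q.out = g q.out) : f = g :=
  IndSpace.ext fun x => IndSpace.apply_eq_of_coset f g (QuotientGroup.out_eq' (x : G ⧸ H)) (h _)

section Translate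

variable {N : Subgroup G} [N.Normal] {χ : N →* Circle}

/-- `σ` restricts to a multiple of `χ` on `N`. -/
def ActsBy (hNH : N ≤ H) (σ : UnitaryRep H) (χ : N →* Circle) : Prop :=
  ∀ (n : N) (v : σ.H), σ.act (Subgroup.inclusion hNH n) v = (χ n : ℂ) • v

/-- Moving `n` past `x` turns it into `x⁻¹ n x ∈ N ≤ H`, where equivariance applies. Thus `N` acts
on the values over the coset `x H` through the conjugate of `χ` by `x`. -/
theorem translate_apply_of_actsBy {hNH : N ≤ H} (hσ : ActsBy hNH σ χ) (f : IndSpace σ) (n : N)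
    (x : G) : translate (n : G) f x =
      (χ ((MulAut.conjNormal x⁻¹ : MulAut N) n) : ℂ) • f x := by
  rw [translate_apply, ← hσ]
  have h1 : (n : G)⁻¹ * x =
      x * ((Subgroup.inclusion hNH ((MulAut.conjNormal x⁻¹ : MulAut N) n))⁻¹ : H) := by
    simp [mul_assoc]
  rw [h1, f.map_mul, inv_inv]

end Translate

variable [Fintype (G ⧸ H)]

theorem IndSpace.inner_eq_sum (f g : IndSpace σ) :
    inner ℂ f g = ∑ q : G ⧸ H, inner ℂ (f q.out) (g q.out) := by
  rw [IndSpace.inner_eq, tsum_fintype]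

open Classical in
variable (σ) in
/-- The embedding of `H_σ` into the space of the induced representation as the space of functions
supported on `H`. -/
def IndSpace.delta : σ.H →ₗᵢ[ℂ] IndSpace σ :=
  LinearMap.isometryOfInner
    { toFun := fun v => ⟨fun x => if hx : x ∈ H then σ.act ⟨x, hx⟩⁻¹ v else 0, by
        constructor
        · intro x h
          by_cases hx : x ∈ H
          · have hxh : x * h ∈ H := H.mul_mem hx h.2
            dsimp only
            rw [dif_pos hx, dif_pos hxh, ← UnitaryRep.act_mul_apply, ← mul_inv_rev]
            rfl
          · have hxh : x * h ∉ H := fun h' => hx ((H.mul_mem_cancel_right h.2).1 h')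
            dsimp only
            rw [dif_neg hx, dif_neg hxh, map_zero]
        · exact Memℓp.all _⟩
      map_add' := fun v w => IndSpace.ext fun x => by
        change (if hx : x ∈ H then σ.act ⟨x, hx⟩⁻¹ (v + w) else 0) =
          (if hx : x ∈ H then σ.act ⟨x, hx⟩⁻¹ v else 0) +
            (if hx : x ∈ H then σ.act ⟨x, hx⟩⁻¹ w else 0)
        split_ifs <;> simp
      map_smul' := fun c v => IndSpace.ext fun x => by
        change (if hx : x ∈ H then σ.act ⟨x, hx⟩⁻¹ (c • v) else 0) =
          c • (if hx : x ∈ H then σ.act ⟨x, hx⟩⁻¹ v else 0)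
        split_ifs <;> simp } (by
    intro v w
    rw [IndSpace.inner_eq_sum, Finset.sum_eq_single ((1 : G) : G ⧸ H)]
    · have h1 : ((1 : G) : G ⧸ H).out ∈ H := by
        have := QuotientGroup.eq.1 (QuotientGroup.out_eq' ((1 : G) : G ⧸ H))
        simpa using this
      change inner ℂ (dite _ _ _) (dite _ _ _) = _
      rw [dif_pos h1, dif_pos h1, LinearIsometryEquiv.inner_map_map]
    · intro q _ hq
      have h1 : q.out ∉ H := fun h1 => hq <| by
        rw [← QuotientGroup.out_eq' q]
        exact QuotientGroup.eq.2 (by simpa using h1)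
      change inner ℂ (dite _ _ _) _ = _
      rw [dif_neg h1, inner_zero_left]
    · intro h
      exact absurd (Finset.mem_univ _) h)

theorem IndSpace.delta_apply_coe (v : σ.H) (h : H) : IndSpace.delta σ v h = σ.act h⁻¹ v :=
  dif_pos h.2

theorem IndSpace.delta_apply_one (v : σ.H) : IndSpace.delta σ v 1 = v := by
  rw [← H.coe_one, IndSpace.delta_apply_coe, inv_one, UnitaryRep.act_one_apply]

theorem IndSpace.delta_apply_of_notMem (v : σ.H) {x : G} (hx : x ∉ H) :
    IndSpace.delta σ v x = 0 :=
  dif_neg hx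

theorem IndSpace.eq_sum_translate_delta (f : IndSpace σ) :
    f = ∑ q : G ⧸ H, translate q.out (IndSpace.delta σ (f q.out)) := by
  refine IndSpace.ext_out fun p => ?_
  rw [IndSpace.sum_apply, Finset.sum_eq_single p]
  · rw [translate_apply, inv_mul_cancel, IndSpace.delta_apply_one]
  · intro q _ hq
    rw [translate_apply, IndSpace.delta_apply_of_notMem]
    intro h
    apply hq
    rw [← QuotientGroup.out_eq' q, ← QuotientGroup.out_eq' p]
    exact QuotientGroup.eq.2 h
  · intro h
    exact absurd (Finset.mem_univ _) h

/-- An irreducible representation `π` of `G` is induced from `σ` as soon as `σ` embeds into the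
restriction of `π` to `H` with image orthogonal to its translates by elements outside `H`. -/
theorem equivalent_ind_of_orthogonal {π : UnitaryRep G} (hπ : π.IsIrreducible) [Nontrivial σ.H]
    (j : σ.H →ₗᵢ[ℂ] π.H) (hj : ∀ (h : H) v, j (σ.act h v) = π.act h (j v))
    (horth : ∀ g ∉ H, ∀ v w, inner ℂ (j v) (π.act g (j w)) = 0) :
    UnitaryRep.Equivalent π (ind σ) := by
  -- Each summand of `Ψ` below is independent of the coset representative, which is what makes `Ψ`
  -- commute with `G`.
  have hcoset : ∀ (f : IndSpace σ) {x y : G}, (x : G ⧸ H) = y →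
      π.act x (j (f x)) = π.act y (j (f y)) := by
    intro f x y hxy
    have hy : y = x * (⟨x⁻¹ * y, QuotientGroup.eq.1 hxy⟩ : H) := by simp
    rw [hy, f.map_mul, hj, π.act_mul_apply, Subgroup.coe_inv, π.act_act_inv]
  let Ψ : IndSpace σ →ₗᵢ[ℂ] π.H := LinearMap.isometryOfInner
    { toFun := fun f => ∑ q : G ⧸ H, π.act q.out (j (f q.out))
      map_add' := fun f g => by
        rw [← Finset.sum_add_distrib]
        refine Finset.sum_congr rfl fun q _ => ?_
        rw [← map_add, ← map_add]; rfl
      map_smul' := fun c f => by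
        rw [Finset.smul_sum]
        refine Finset.sum_congr rfl fun q _ => ?_
        rw [RingHom.id_apply, ← map_smul, ← map_smul]; rfl } (by
    intro f g
    rw [IndSpace.inner_eq_sum]
    change inner ℂ (∑ q : G ⧸ H, π.act q.out (j (f q.out)))
      (∑ q : G ⧸ H, π.act q.out (j (g q.out))) = _
    rw [sum_inner]
    refine Finset.sum_congr rfl fun p _ => ?_
    rw [inner_sum, Finset.sum_eq_single p]
    · rw [LinearIsometryEquiv.inner_map_map, LinearIsometry.inner_map_map]
    · intro q _ hq
      rw [π.inner_act_left, ← π.act_mul_apply]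
      apply horth
      intro h
      apply hq
      rw [← QuotientGroup.out_eq' q, ← QuotientGroup.out_eq' p, eq_comm]
      exact QuotientGroup.eq.2 h
    · intro h
      exact absurd (Finset.mem_univ _) h)
  have hΨ : ∀ f, Ψ f = ∑ q : G ⧸ H, π.act q.out (j (f q.out)) := fun f => rfl
  have hint : ∀ g f, Ψ (translate g f) = π.act g (Ψ f) := by
    intro g f
    rw [hΨ, hΨ, map_sum, ← Equiv.sum_comp (MulAction.toPerm g)]
    refine Finset.sum_congr rfl fun q _ => ?_
    have h1 : (((MulAction.toPerm g q : G ⧸ H).out : G) : G ⧸ H) = (g * q.out : G) := by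
      rw [QuotientGroup.out_eq']
      conv_lhs => rw [← QuotientGroup.out_eq' q]
      rfl
    rw [hcoset _ h1, translate_apply, inv_mul_cancel_left, π.act_mul_apply]
  have hnt : Nontrivial (IndSpace σ) := (IndSpace.delta σ).injective.nontrivial
  have hsurj : Function.Surjective Ψ := by
    -- The range of an isometry from a complete space is closed; it is invariant and nonzero, so
    -- irreducibility of `π` makes it everything.
    rcases hπ.2 (LinearMap.range Ψ.toLinearMap) Ψ.isometry.isClosedEmbedding.isClosed_range (by
      rintro g _ ⟨f, rfl⟩
      exact ⟨translate g f, hint g f⟩) with h | h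
    · obtain ⟨f, hf⟩ := exists_ne (0 : IndSpace σ)
      exfalso
      apply hf
      apply Ψ.injective
      rw [map_zero]
      exact (Submodule.eq_bot_iff _).1 h _ ⟨f, rfl⟩
    · exact LinearMap.range_eq_top.1 h
  refine (UnitaryRep.setoid G).symm (a := ind σ)
    ⟨LinearIsometryEquiv.ofSurjective Ψ hsurj, fun g f => hint g f⟩

variable {N : Subgroup G} [N.Normal] {χ : N →* Circle}

/-- Distinct cosets of `H` carry distinct conjugates of `χ`, because `H` contains the stabilizer.
Polynomials in the translations by `N` therefore isolate the values over a single coset without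
leaving `K`. -/
theorem exists_mem_supported_of_actsBy {hNH : N ≤ H} (hσ : ActsBy hNH σ χ)
    (hχ : ∀ g : G, (∀ n, χ ((MulAut.conjNormal g⁻¹ : MulAut N) n) = χ n) → g ∈ H)
    {K : Submodule ℂ (IndSpace σ)} (hK : ∀ (n : N), ∀ f ∈ K, translate (n : G) f ∈ K)
    {f : IndSpace σ} (hf : f ∈ K) (p : G ⧸ H) :
    ∃ f' ∈ K, f' p.out = f p.out ∧ ∀ q : G ⧸ H, q ≠ p → f' q.out = 0 := by
  classical
  suffices h : ∀ S : Finset (G ⧸ H), p ∉ S →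
      ∃ f' ∈ K, f' p.out = f p.out ∧ ∀ q ∈ S, f' q.out = 0 by
    obtain ⟨f', h1, h2, h3⟩ := h (Finset.univ.erase p) (by simp)
    exact ⟨f', h1, h2, fun q hq => h3 q (by simp [hq])⟩
  intro S
  induction S using Finset.induction_on with
  | empty => exact fun _ => ⟨f, hf, rfl, by simp⟩
  | insert b S _ ih =>
    intro hp
    rw [Finset.mem_insert, not_or] at hp
    obtain ⟨f', h1, h2, h3⟩ := ih hp.2
    obtain ⟨n, hn⟩ : ∃ n, χ ((MulAut.conjNormal (p.out)⁻¹ : MulAut N) n) ≠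
        χ ((MulAut.conjNormal (b.out)⁻¹ : MulAut N) n) := by
      by_contra! hall
      apply hp.1
      rw [← QuotientGroup.out_eq' p, ← QuotientGroup.out_eq' b, eq_comm]
      refine QuotientGroup.eq.2 (hχ _ fun n => ?_)
      have := hall ((MulAut.conjNormal b.out : MulAut N) n)
      rw [← MulAut.mul_apply, ← map_mul, ← MulAut.mul_apply, ← map_mul, inv_mul_cancel, map_one,
        MulAut.one_apply] at this
      rw [mul_inv_rev, inv_inv, this]
    set c : ℂ := ((χ ((MulAut.conjNormal (p.out)⁻¹ : MulAut N) n) : Circle) : ℂ) with hc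
    set d : ℂ := ((χ ((MulAut.conjNormal (b.out)⁻¹ : MulAut N) n) : Circle) : ℂ) with hd
    have hcd : c - d ≠ 0 := fun h => hn (Circle.ext (sub_eq_zero.1 h))
    have hval : ∀ x, ((c - d)⁻¹ • (translate (n : G) f' - d • f') : IndSpace σ) x =
        (c - d)⁻¹ • ((χ ((MulAut.conjNormal x⁻¹ : MulAut N) n) : ℂ) • f' x - d • f' x) := by
      intro x
      rw [← translate_apply_of_actsBy hσ]
      rfl
    -- Here `n` acts by `c` over `p` and by `d ≠ c` over `b`, so `(n - d) / (c - d)` keeps the value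
    -- at `p`, kills the one at `b`, and preserves zeros elsewhere.
    refine ⟨(c - d)⁻¹ • (translate (n : G) f' - d • f'),
      K.smul_mem _ (K.sub_mem (hK n f' h1) (K.smul_mem _ h1)), ?_, ?_⟩
    · rw [hval, ← hc, ← sub_smul, smul_smul, inv_mul_cancel₀ hcd, one_smul, h2]
    · intro q hq
      rw [hval]
      obtain rfl | hq := Finset.mem_insert.1 hq
      · rw [← hd, sub_self, smul_zero]
      · rw [h3 q hq, smul_zero, smul_zero, sub_zero, smul_zero]

/-- Mackey's irreducibility criterion: if `σ` is irreducible, restricts to a multiple of `χ` on the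
normal subgroup `N`, and `H` contains the stabilizer of `χ`, then `ind σ` is irreducible. -/
theorem ind_isIrreducible {hNH : N ≤ H} (hσ : ActsBy hNH σ χ)
    (hχ : ∀ g : G, (∀ n, χ ((MulAut.conjNormal g⁻¹ : MulAut N) n) = χ n) → g ∈ H)
    (hirr : σ.IsIrreducible) : (ind σ).IsIrreducible := by
  have := hirr.1
  refine ⟨(IndSpace.delta σ).injective.nontrivial, fun (K : Submodule ℂ (IndSpace σ)) hKc hK => ?_⟩
  have hK' : ∀ g, ∀ f ∈ K, translate g f ∈ K := hK
  -- Irreducibility of `σ` is applied to the part of `K` supported on `H`. If it is zero, then so is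
  -- `K`, because any value of a member of `K` can be moved to the identity coset and isolated
  -- there; if it is all of `H_σ`, its translates sum to the whole space.
  rcases hirr.2 (K.comap (IndSpace.delta σ).toLinearMap)
    (hKc.preimage (IndSpace.delta σ).continuous) (by
      intro h v hv
      rw [Submodule.mem_comap] at hv ⊢
      convert! hK' h _ hv using 1
      refine IndSpace.ext fun x => ?_
      change IndSpace.delta σ (σ.act h v) x = translate (h : G) (IndSpace.delta σ v) x
      rw [translate_apply]
      by_cases hx : x ∈ H
      · lift x to H using hx
        rw [IndSpace.delta_apply_coe, ← H.coe_inv, ← H.coe_mul, IndSpace.delta_apply_coe,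
          ← UnitaryRep.act_mul_apply, mul_inv_rev, inv_inv]
      · rw [IndSpace.delta_apply_of_notMem _ hx, IndSpace.delta_apply_of_notMem]
        rwa [H.mul_mem_cancel_left (H.inv_mem h.2)]) with h | h
  · left
    refine (Submodule.eq_bot_iff K).2 fun f hf => ?_
    refine IndSpace.ext fun x => ?_
    obtain ⟨f', hf', h1, h2⟩ := exists_mem_supported_of_actsBy hσ hχ (fun n => hK' n)
      (hK' x⁻¹ f hf) ((1 : G) : G ⧸ H)
    have h3 : f' 1 = f x := by
      rw [IndSpace.apply_eq_of_coset _ _ (QuotientGroup.out_eq' _) h1, translate_apply, inv_inv,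
        mul_one]
    have h4 : f' = IndSpace.delta σ (f x) := by
      refine IndSpace.ext fun y => ?_
      by_cases hy : y ∈ H
      · lift y to H using hy
        rw [IndSpace.delta_apply_coe, ← h3, ← f'.map_mul, one_mul]
      · rw [IndSpace.delta_apply_of_notMem _ hy]
        refine IndSpace.apply_eq_of_coset f' 0 (QuotientGroup.out_eq' (y : G ⧸ H)) (h2 _ ?_)
        intro h5
        exact hy (by simpa using QuotientGroup.eq.1 h5.symm)
    have h5 : f x ∈ K.comap (IndSpace.delta σ).toLinearMap := by
      rw [Submodule.mem_comap]
      change IndSpace.delta σ (f x) ∈ K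
      rwa [← h4]
    rw [h, Submodule.mem_bot] at h5
    exact h5
  · right
    refine (Submodule.eq_top_iff' (p := K)).2 fun f => ?_
    rw [IndSpace.eq_sum_translate_delta f]
    refine K.sum_mem fun q _ => hK' _ _ ?_
    have : f.1 q.out ∈ K.comap (IndSpace.delta σ).toLinearMap := h ▸ Submodule.mem_top
    exact this

end Induced

/-! ### Clifford theory: isotypic subspaces and induction from the stabilizer. -/

section Clifford

variable {G : Type} [Group G]

namespace UnitaryRep

/-- The representation of a subgroup on a closed invariant subspace. -/
def subrep (π : UnitaryRep G) (H : Subgroup G) (W : Submodule ℂ π.H) (hc : IsClosed (W : Set π.H))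
    (hW : ∀ h : H, ∀ v ∈ W, π.act h v ∈ W) : UnitaryRep H where
  H := W
  instComplete := hc.completeSpace_coe
  act :=
    { toFun := fun g =>
        { toFun := fun v => ⟨π.act g v, hW g v v.2⟩
          invFun := fun v => ⟨π.act (g⁻¹ : H) v, hW g⁻¹ v v.2⟩
          map_add' := fun v w => Subtype.ext (map_add (π.act (g : G)) (v : π.H) w)
          map_smul' := fun c v => Subtype.ext (map_smul (π.act (g : G)) c (v : π.H))
          left_inv := fun v => Subtype.ext (π.act_inv_act g v)
          right_inv := fun v => Subtype.ext (π.act_act_inv g v)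
          norm_map' := fun v => (π.act (g : G)).norm_map v }
      map_one' := LinearIsometryEquiv.ext fun v => Subtype.ext (π.act_one_apply v)
      map_mul' := fun g h => LinearIsometryEquiv.ext fun v => Subtype.ext (π.act_mul_apply g h v) }

/-- Irreducibility depends only on the equivalence class. -/
theorem IsIrreducible.of_equivalent {π σ : UnitaryRep G} (hπ : π.IsIrreducible)
    (h : π.Equivalent σ) : σ.IsIrreducible := by
  obtain ⟨U, hU⟩ := h
  have := hπ.1
  refine ⟨U.injective.nontrivial, fun K hKc hK => ?_⟩
  rcases hπ.2 (K.comap (U : π.H →ₗ[ℂ] σ.H)) (hKc.preimage U.continuous) (fun g v hv => by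
    change U (π.act g v) ∈ K
    rw [hU]
    exact hK g _ hv) with h | h
  · left
    refine (Submodule.eq_bot_iff K).2 fun w hw => ?_
    have h1 : U.symm w ∈ K.comap (U : π.H →ₗ[ℂ] σ.H) := by
      change U (U.symm w) ∈ K
      rwa [U.apply_symm_apply]
    rw [h, Submodule.mem_bot] at h1
    exact U.symm.map_eq_zero_iff.1 h1
  · right
    refine Submodule.eq_top_iff'.2 fun w => ?_
    have h1 : U.symm w ∈ K.comap (U : π.H →ₗ[ℂ] σ.H) := h ▸ Submodule.mem_top
    have h2 : U (U.symm w) ∈ K := h1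
    rwa [U.apply_symm_apply] at h2

theorem ofCharacter_isIrreducible (χ : G →* Circle) : (ofCharacter χ).IsIrreducible :=
  ⟨inferInstanceAs (Nontrivial ℂ), fun K _ _ =>
    eq_bot_or_eq_top (α := Submodule ℂ ℂ) K⟩

/-- A representation is a multiple of the character `χ` if and only if it acts by `χ`. -/
theorem isMultipleOf_ofCharacter_iff (σ : UnitaryRep G) (χ : G →* Circle) :
    σ.IsMultipleOf (ofCharacter χ) ↔ ∀ g v, σ.act g v = (χ g : ℂ) • v := by
  constructor
  · rintro ⟨I, U, hU⟩ g v
    apply U.injective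
    rw [map_smul]
    ext i
    exact hU g v i
  · intro h
    obtain ⟨w, b, -⟩ := exists_hilbertBasis ℂ σ.H
    refine ⟨w, b.repr, fun g v i => ?_⟩
    rw [h]
    exact congrArg (fun f : lp (fun _ : w => ℂ) 2 => f i) (map_smul b.repr (χ g : ℂ) v)

variable {N : Subgroup G}

/-- The subspace on which `N` acts by the character `χ`. -/
def isotypic (π : UnitaryRep G) (χ : N →* Circle) : Submodule ℂ π.H where
  carrier := {v | ∀ n : N, π.act n v = (χ n : ℂ) • v}
  zero_mem' := fun n => by simp
  add_mem' := fun {v w} hv hw n => by rw [map_add, hv, hw, smul_add]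
  smul_mem' := fun c v hv n => by rw [map_smul, hv, smul_comm]

theorem isClosed_isotypic (π : UnitaryRep G) (χ : N →* Circle) :
    IsClosed (π.isotypic χ : Set π.H) := by
  have : (π.isotypic χ : Set π.H) = ⋂ n : N, {v | π.act n v = (χ n : ℂ) • v} := by
    ext v; simp [isotypic]
  rw [this]
  exact isClosed_iInter fun n => isClosed_eq (π.act n).continuous (continuous_const_smul _)

theorem act_mem_isotypic [N.Normal] (π : UnitaryRep G) {χ χ' : N →* Circle} {g : G}
    (hg : ∀ n, χ' n = χ ((MulAut.conjNormal g⁻¹ : MulAut N) n)) {v : π.H}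
    (hv : v ∈ π.isotypic χ) : π.act g v ∈ π.isotypic χ' := by
  intro n
  have h1 : (n : G) * g = g * ((MulAut.conjNormal g⁻¹ : MulAut N) n : N) := by
    simp [mul_assoc]
  rw [← act_mul_apply, h1, act_mul_apply, hv, map_smul, hg]

/-- If `χ n ≠ χ' n`, the unitary `π(n)` multiplies the inner product by `(χ n)⁻¹ χ' n ≠ 1` and also
preserves it. -/
theorem inner_eq_zero_of_mem_isotypic (π : UnitaryRep G) {χ χ' : N →* Circle} (h : χ ≠ χ')
    {v w : π.H} (hv : v ∈ π.isotypic χ) (hw : w ∈ π.isotypic χ') : inner ℂ v w = 0 := by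
  obtain ⟨n, hn⟩ := DFunLike.ne_iff.1 h
  have h1 := (π.act n).inner_map_map v w
  rw [hv, hw, inner_smul_left, inner_smul_right, ← mul_assoc, ← Circle.coe_inv_eq_conj,
    ← Circle.coe_mul] at h1
  by_contra h0
  exact hn (inv_mul_eq_one.1 (Circle.ext ((mul_eq_right₀ h0).1 h1)))

end UnitaryRep

variable {H N : Subgroup G} [N.Normal] {χ : N →* Circle} [Fintype (G ⧸ H)]

theorem inner_act_eq_zero_of_mem_isotypic {π : UnitaryRep G} {v w : π.H}
    (hv : v ∈ π.isotypic χ) (hw : w ∈ π.isotypic χ) {g : G}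
    (hg : ¬ ∀ n, χ ((MulAut.conjNormal g⁻¹ : MulAut N) n) = χ n) :
    inner ℂ v (π.act g w) = 0 := by
  refine π.inner_eq_zero_of_mem_isotypic (χ := χ)
    (χ' := χ.comp (MulAut.conjNormal g⁻¹ : MulAut N).toMonoidHom) (fun h => hg fun n => ?_) hv
    (π.act_mem_isotypic (fun n => rfl) hw)
  conv_rhs => rw [h]
  rfl

/-- Clifford's theorem: an irreducible representation which contains the character `χ` of a normal
subgroup is induced from an irreducible representation of the stabilizer of `χ` on which the normal
subgroup acts by `χ`. -/
theorem exists_equivalent_ind {π : UnitaryRep G} (hπ : π.IsIrreducible) (hNH : N ≤ H)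
    (hH : ∀ g : G, g ∈ H ↔ ∀ n, χ ((MulAut.conjNormal g⁻¹ : MulAut N) n) = χ n)
    (hχ : π.isotypic χ ≠ ⊥) :
    ∃ σ : UnitaryRep H, σ.IsIrreducible ∧ ActsBy hNH σ χ ∧ π.Equivalent (ind σ) := by
  let σ : UnitaryRep H := π.subrep H (π.isotypic χ) (π.isClosed_isotypic χ)
    (fun h v hv => π.act_mem_isotypic (fun n => (((hH h).1 h.2) n).symm) hv)
  have hnt : Nontrivial σ.H := (Submodule.nontrivial_iff_ne_bot).2 hχ
  refine ⟨σ, ⟨hnt, fun (K : Submodule ℂ (π.isotypic χ)) hKc hK => ?_⟩,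
    fun n v => Subtype.ext (v.2 n), ?_⟩
  · by_cases hK0 : K = ⊥
    · exact Or.inl hK0
    right
    -- The orthogonal complement of all `G`-translates of `K`: closed and invariant, and not
    -- everything since `K ≠ 0`; hence zero.
    let M : Submodule ℂ π.H :=
      ⨅ (g : G) (k : K), LinearMap.ker (innerSL ℂ (π.act g (k : π.isotypic χ))).toLinearMap
    have hM : ∀ w, w ∈ M ↔ ∀ (g : G), ∀ k ∈ K, inner ℂ (π.act g (k : π.H)) w = 0 := by
      intro w
      simp [M, Submodule.mem_iInf]
    have hMbot : M = ⊥ := by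
      refine (hπ.2 M ?_ ?_).resolve_right ?_
      · have : (M : Set π.H) = ⋂ (g : G) (k : K),
            {w | inner ℂ (π.act g ((k : π.isotypic χ) : π.H)) w = 0} := by
          ext w; simp [M]
        rw [this]
        exact isClosed_iInter fun g => isClosed_iInter fun k =>
          isClosed_eq (by fun_prop) continuous_const
      · intro g w hw
        rw [hM] at hw ⊢
        intro g' k hk
        rw [π.inner_act_right, ← π.act_mul_apply]
        exact hw _ k hk
      · intro htop
        apply hK0
        refine (Submodule.eq_bot_iff K).2 fun k hk => Subtype.ext ?_
        have h1 : (k : π.H) ∈ M := htop ▸ Submodule.mem_top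
        have h2 := (hM _).1 h1 1 k hk
        rw [π.act_one_apply] at h2
        exact inner_self_eq_zero.1 h2
    have hcomplete : CompleteSpace (π.isotypic χ) := (π.isClosed_isotypic χ).completeSpace_coe
    have : CompleteSpace K := hKc.completeSpace_coe
    refine Submodule.orthogonal_eq_bot_iff.1 ((Submodule.eq_bot_iff _).2 fun w hw => ?_)
    -- A vector of the isotypic subspace orthogonal to `K` is orthogonal to all translates of `K`:
    -- elements of `H` preserve `K`, and elements outside `H` move it into the isotypic subspace of
    -- a different character.
    have hwM : (w : π.H) ∈ M := by
      rw [hM]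
      intro g k hk
      by_cases hg : g ∈ H
      · exact hw _ (hK ⟨g, hg⟩ k hk)
      · rw [← inner_conj_symm,
          inner_act_eq_zero_of_mem_isotypic w.2 k.2 (fun h => hg ((hH g).2 h)), map_zero]
    rw [hMbot, Submodule.mem_bot] at hwM
    exact Subtype.ext hwM
  · exact equivalent_ind_of_orthogonal hπ (σ := σ) (π.isotypic χ).subtypeₗᵢ (fun _ _ => rfl)
      fun g hg v w => inner_act_eq_zero_of_mem_isotypic v.2 w.2 (fun h => hg ((hH g).2 h))

/-- An irreducible representation which contains a character `χ` of a normal subgroup whose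
stabilizer is the normal subgroup itself is induced from `χ`. -/
theorem equivalent_ind_ofCharacter [Fintype (G ⧸ N)] {π : UnitaryRep G} (hπ : π.IsIrreducible)
    (hN : ∀ g : G, (∀ n, χ ((MulAut.conjNormal g⁻¹ : MulAut N) n) = χ n) → g ∈ N)
    (hχ : π.isotypic χ ≠ ⊥) : π.Equivalent (ind (UnitaryRep.ofCharacter χ)) := by
  obtain ⟨v, hv, hv0⟩ := Submodule.exists_mem_ne_zero_of_ne_bot hχ
  -- Normalized so that `z ↦ z • u` is an isometric embedding of `ℂ`.
  set u : π.H := ((‖v‖ : ℂ)⁻¹) • v with hu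
  have hu1 : ‖u‖ = 1 := by
    rw [hu, norm_smul, norm_inv, Complex.norm_real, norm_norm,
      inv_mul_cancel₀ (norm_ne_zero_iff.2 hv0)]
  have huχ : u ∈ π.isotypic χ := Submodule.smul_mem _ _ hv
  have : Nontrivial (UnitaryRep.ofCharacter χ).H := inferInstanceAs (Nontrivial ℂ)
  refine equivalent_ind_of_orthogonal hπ (σ := UnitaryRep.ofCharacter χ)
    (LinearIsometry.toSpanSingleton ℂ π.H hu1 : ℂ →ₗᵢ[ℂ] π.H)
    (fun n (z : ℂ) => ?_) fun g hg (z w : ℂ) => ?_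
  · change ((χ n : ℂ) * z) • u = π.act n (z • u)
    rw [map_smul, huχ n, mul_comm]
    exact mul_smul z (χ n : ℂ) u
  · exact inner_act_eq_zero_of_mem_isotypic (Submodule.smul_mem _ z huχ)
      (Submodule.smul_mem _ w huχ) fun h => hg (hN g h)

end Clifford

/-! ### Bieberbach's first theorem -/

section Bieberbach

/-- In a finite-dimensional space, a family with bounded values indexed by an infinite set has two
distinct members with close values. -/
theorem exists_ne_dist_lt {ι X : Type*} [PseudoMetricSpace X] [ProperSpace X] {S : Set ι}
    (hS : S.Infinite) {f : ι → X} (hf : Bornology.IsBounded (f '' S)) {ε : ℝ} (hε : 0 < ε) :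
    ∃ s ∈ S, ∃ t ∈ S, s ≠ t ∧ dist (f s) (f t) < ε := by
  obtain ⟨c, hc, hcov⟩ := Metric.totallyBounded_iff.1
    (hf.isCompact_closure.totallyBounded.subset subset_closure) (ε / 2) (half_pos hε)
  have : Nonempty X := hS.nonempty.elim fun s _ => ⟨f s⟩
  have : ∀ s ∈ S, ∃ y ∈ c, dist (f s) y < ε / 2 := by
    intro s hs
    simpa using hcov (Set.mem_image_of_mem f hs)
  choose! y hy hd using this
  obtain ⟨s, hs, t, ht, hst, h⟩ := hS.exists_ne_map_eq_of_mapsTo hy hc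
  refine ⟨s, hs, t, ht, hst, ?_⟩
  calc dist (f s) (f t) ≤ dist (f s) (y s) + dist (f t) (y s) := dist_triangle_right _ _ _
    _ < ε / 2 + ε / 2 := add_lt_add (hd s hs) (h ▸ hd t ht)
    _ = ε := add_halves ε

theorem exists_norm_eq_opNorm {V W : Type*} [NormedAddCommGroup V] [NormedSpace ℝ V]
    [FiniteDimensional ℝ V] [Nontrivial V] [NormedAddCommGroup W] [NormedSpace ℝ W]
    (M : V →L[ℝ] W) : ∃ x, ‖x‖ = 1 ∧ ‖M x‖ = ‖M‖ := by
  have := FiniteDimensional.proper ℝ V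
  obtain ⟨x, hx, hmax⟩ := (isCompact_sphere (0 : V) 1).exists_isMaxOn
    (NormedSpace.sphere_nonempty.2 zero_le_one) (f := fun x => ‖M x‖) (by fun_prop)
  have hx1 : ‖x‖ = 1 := mem_sphere_zero_iff_norm.1 hx
  refine ⟨x, hx1, le_antisymm (by simpa [hx1] using M.le_opNorm x) ?_⟩
  exact M.opNorm_le_of_unit_norm (norm_nonneg _) fun z hz => hmax (mem_sphere_zero_iff_norm.2 hz)

/-- The spectral gap of a normal operator at its norm: the space splits orthogonally, compatibly
with `M`, into a nonzero part on which `M` stretches by `‖M‖` and a part on which it stretches by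
at most `m' < ‖M‖`. -/
theorem exists_projection_gap {V : Type*} [NormedAddCommGroup V] [InnerProductSpace ℝ V]
    [FiniteDimensional ℝ V] {M : V →L[ℝ] V} (hM0 : M ≠ 0)
    (hM : ∀ x, M (ContinuousLinearMap.adjoint M x) = ContinuousLinearMap.adjoint M (M x)) :
    ∃ (P : V →L[ℝ] V) (m' : ℝ), 0 ≤ m' ∧ m' < ‖M‖ ∧ (∀ x, P (M x) = M (P x)) ∧
      (∀ x, ‖P x‖ ≤ ‖x‖) ∧ (∀ x, ‖x - P x‖ ≤ ‖x‖) ∧ (∀ x, ‖M (P x)‖ = ‖M‖ * ‖P x‖) ∧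
      (∀ x, ‖M (x - P x)‖ ≤ m' * ‖x - P x‖) ∧ ∃ u, ‖u‖ = 1 ∧ P u = u := by
  set M' := ContinuousLinearMap.adjoint M with hM'
  have hinner : ∀ x y, inner ℝ (M' x) y = inner ℝ x (M y) := fun x y =>
    ContinuousLinearMap.adjoint_inner_left M y x
  set m := ‖M‖ with hm
  have hm0 : 0 < m := norm_pos_iff.2 hM0
  have hnt : Nontrivial V := by
    by_contra h
    rw [not_nontrivial_iff_subsingleton] at h
    exact hM0 (by ext x; exact Subsingleton.elim _ _)
  -- `F` is the top eigenspace of `M' M`, which is also the set of vectors stretched by exactly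
  -- `‖M‖`. By normality `M` and `M'` preserve `F`, so `M` preserves `Fᗮ` too.
  let F : Submodule ℝ V := LinearMap.ker (M' ∘L M - (m ^ 2) • ContinuousLinearMap.id ℝ V).toLinearMap
  have hF : ∀ x, x ∈ F ↔ M' (M x) = (m ^ 2) • x := by
    intro x
    simp [F, sub_eq_zero]
  have hFnorm : ∀ x, x ∈ F ↔ ‖M x‖ = m * ‖x‖ := by
    intro x
    have h0 : inner ℝ (M' (M x)) x = ‖M x‖ ^ 2 := by
      rw [hinner, real_inner_self_eq_norm_sq]
    rw [hF]
    constructor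
    · intro h
      rw [h, real_inner_smul_left, real_inner_self_eq_norm_sq, ← mul_pow] at h0
      exact ((sq_eq_sq₀ (by positivity) (by positivity)).1 h0).symm
    · intro h
      rw [← sub_eq_zero, ← norm_eq_zero, ← sq_eq_zero_iff]
      refine le_antisymm ?_ (sq_nonneg _)
      have h1 : ‖M' (M x)‖ ≤ m * ‖M x‖ := by
        have := M'.le_opNorm (M x)
        rwa [hM', LinearIsometryEquiv.norm_map] at this
      have h2 : ‖M' (M x)‖ ^ 2 ≤ (m ^ 2 * ‖x‖) ^ 2 := by
        refine pow_le_pow_left₀ (norm_nonneg _) (h1.trans_eq ?_) 2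
        rw [h]; ring
      rw [norm_sub_sq_real, real_inner_smul_right, h0, h, norm_smul, Real.norm_of_nonneg (by positivity)]
      linarith
  have hMF : ∀ x ∈ F, M x ∈ F := by
    intro x hx
    rw [hF] at hx ⊢
    rw [← hM, hx, map_smul]
  have hMF' : ∀ x ∈ F, M' x ∈ F := by
    intro x hx
    rw [hF] at hx ⊢
    rw [hM, hx, map_smul]
  have hMFo : ∀ x ∈ Fᗮ, M x ∈ Fᗮ := by
    intro x hx
    rw [Submodule.mem_orthogonal] at hx ⊢
    intro y hy
    rw [← hinner]
    exact hx _ (hMF' y hy)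
  set P := F.starProjection with hP
  have hPF : ∀ x, P x ∈ F := fun x => F.starProjection_apply_mem x
  have hPFo : ∀ x, x - P x ∈ Fᗮ := fun x => F.sub_starProjection_mem_orthogonal x
  refine ⟨P, ‖M ∘L Fᗮ.subtypeL‖, norm_nonneg (M ∘L Fᗮ.subtypeL), ?_, ?_, ?_, ?_, ?_, ?_, ?_⟩
  · refine lt_of_le_of_ne ?_ ?_
    · refine ContinuousLinearMap.opNorm_le_bound _ hm0.le fun x => ?_
      exact M.le_opNorm x
    -- If `M` had norm `m` on `Fᗮ`, compactness of the unit sphere would give a unit vector of `Fᗮ`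
    -- stretched by `m`, hence lying in `F` as well.
    · intro heq
      rcases subsingleton_or_nontrivial Fᗮ with h | h
      · have : M ∘L Fᗮ.subtypeL = 0 := by
          ext x; rw [Subsingleton.elim x 0, map_zero, map_zero]
        rw [this] at heq
        exact hm0.ne ((norm_zero (E := Fᗮ →L[ℝ] V)).symm.trans heq)
      · obtain ⟨x, hx1, hx⟩ := exists_norm_eq_opNorm (M ∘L Fᗮ.subtypeL)
        have hx2 : ‖(x : V)‖ = 1 := hx1
        have hxF : (x : V) ∈ F := by
          rw [hFnorm]
          change ‖M x‖ = _ at hx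
          rw [hx, heq, hx2, mul_one]
        have := Submodule.inner_right_of_mem_orthogonal hxF x.2
        rw [inner_self_eq_zero] at this
        rw [this, norm_zero] at hx2
        exact zero_ne_one hx2
  · intro x
    refine (Submodule.eq_starProjection_of_mem_orthogonal (hMF _ (hPF x)) ?_)
    rw [← map_sub]
    exact hMFo _ (hPFo x)
  · exact fun x => F.norm_starProjection_apply_le x
  · intro x
    have h1 := norm_add_sq_real (P x) (x - P x)
    rw [Submodule.inner_right_of_mem_orthogonal (hPF x) (hPFo x), add_sub_cancel] at h1
    exact le_of_sq_le_sq (by nlinarith [sq_nonneg ‖P x‖]) (norm_nonneg _)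
  · exact fun x => (hFnorm _).1 (hPF x)
  · exact fun x => (M ∘L Fᗮ.subtypeL).le_opNorm ⟨x - P x, hPFo x⟩
  · obtain ⟨u, hu1, hu⟩ := exists_norm_eq_opNorm M
    exact ⟨u, hu1, Submodule.starProjection_eq_self_iff.2 ((hFnorm u).2 (by rw [hu, hu1, mul_one]))⟩

variable {n : ℕ}

/-- The linear part as a bounded operator. -/
def rot (g : Iso n) : E n →L[ℝ] E n := (linPart g).toContinuousLinearEquiv.toContinuousLinearMap

theorem rot_apply (g : Iso n) (z : E n) : rot g z = linPart g z := rfl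

theorem norm_rot_apply (g : Iso n) (z : E n) : ‖rot g z‖ = ‖z‖ := (linPart g).norm_map z

theorem rot_mul_apply (g h : Iso n) (z : E n) : rot (g * h) z = rot g (rot h z) := by
  rw [rot_apply, map_mul]; rfl

theorem rot_inv_rot (g : Iso n) (z : E n) : rot g⁻¹ (rot g z) = z := by
  rw [← rot_mul_apply, inv_mul_cancel, rot_apply, map_one]; rfl

theorem rot_rot_inv (g : Iso n) (z : E n) : rot g (rot g⁻¹ z) = z := by
  rw [← rot_mul_apply, mul_inv_cancel, rot_apply, map_one]; rfl

theorem rot_injective_iff (g h : Iso n) : rot g = rot h ↔ linPart g = linPart h := by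
  constructor
  · intro H
    ext1 z
    exact DFunLike.congr_fun H z
  · intro H
    rw [rot, rot, H]

theorem rot_eq_one_iff (g : Iso n) : rot g = 1 ↔ linPart g = 1 := by
  rw [← map_one linPart, ← rot_injective_iff]
  rfl

theorem norm_rot_le (g : Iso n) : ‖rot g‖ ≤ 1 :=
  ContinuousLinearMap.opNorm_le_bound _ zero_le_one fun z => by rw [norm_rot_apply, one_mul]

theorem iso_apply (g : Iso n) (z : E n) : g z = rot g z + g 0 := by
  have h := g.map_vadd 0 z
  rwa [vadd_eq_add, vadd_eq_add, add_zero] at h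

theorem iso_mul_apply (g h : Iso n) (z : E n) : (g * h) z = g (h z) := rfl

theorem norm_rot_sub_le (g : Iso n) (z : E n) : ‖rot g z - z‖ ≤ ‖rot g - 1‖ * ‖z‖ :=
  (rot g - 1).le_opNorm z

theorem norm_rot_mul_inv_sub_one_le (g h : Iso n) : ‖rot (g * h⁻¹) - 1‖ ≤ ‖rot g - rot h‖ := by
  refine ContinuousLinearMap.opNorm_le_bound _ (norm_nonneg _) fun z => ?_
  have h1 : (rot (g * h⁻¹) - 1) z = (rot g - rot h) (rot h⁻¹ z) := by
    change rot (g * h⁻¹) z - z = rot g (rot h⁻¹ z) - rot h (rot h⁻¹ z)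
    rw [rot_mul_apply, rot_rot_inv]
  rw [h1]
  refine ((rot g - rot h).le_opNorm _).trans_eq ?_
  rw [norm_rot_apply]

/-- With `A`, `B` the linear parts, `A B A⁻¹ B⁻¹ - 1` is the commutator of `A - 1` and `B - 1`
composed with the isometry `A⁻¹ B⁻¹`. -/
theorem norm_rot_commutator_sub_one_le (g h : Iso n) :
    ‖rot (g * h * g⁻¹ * h⁻¹) - 1‖ ≤ 2 * ‖rot g - 1‖ * ‖rot h - 1‖ := by
  refine ContinuousLinearMap.opNorm_le_bound _ (by positivity) fun z => ?_
  set y := rot g⁻¹ (rot h⁻¹ z) with hy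
  have hyz : ‖y‖ = ‖z‖ := by rw [hy, norm_rot_apply, norm_rot_apply]
  have h1 : (rot (g * h * g⁻¹ * h⁻¹) - 1) z =
      (rot g - 1) ((rot h - 1) y) - (rot h - 1) ((rot g - 1) y) := by
    have hz : z = rot h (rot g y) := by rw [hy, rot_rot_inv, rot_rot_inv]
    change rot (g * h * g⁻¹ * h⁻¹) z - z = (rot g (rot h y - y) - (rot h y - y)) -
      (rot h (rot g y - y) - (rot g y - y))
    rw [rot_mul_apply, rot_mul_apply, rot_mul_apply, ← hy, map_sub, map_sub, ← hz]
    abel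
  rw [h1, ← hyz]
  have e1 := (rot g - 1).le_opNorm ((rot h - 1) y)
  have e2 := (rot h - 1).le_opNorm ((rot g - 1) y)
  have e3 := mul_le_mul_of_nonneg_left ((rot h - 1).le_opNorm y) (norm_nonneg (rot g - 1))
  have e4 := mul_le_mul_of_nonneg_left ((rot g - 1).le_opNorm y) (norm_nonneg (rot h - 1))
  refine (norm_sub_le _ _).trans ?_
  nlinarith

/-- The translation part of a commutator, up to a small error. -/
theorem norm_commutator_sub_le (g h : Iso n) :
    ‖(g * h * g⁻¹ * h⁻¹) 0 - (rot g - 1) (h 0)‖ ≤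
      ‖rot (g * h * g⁻¹ * h⁻¹) - 1‖ * ‖h 0‖ + ‖rot h - 1‖ * ‖g 0‖ := by
  set k := g * h * g⁻¹ * h⁻¹ with hk
  have h1 : k (h (g 0)) = g (h 0) := by
    rw [← iso_mul_apply h g, ← iso_mul_apply k, hk, ← iso_mul_apply g h]
    congr 1
    group
  rw [iso_apply k, iso_apply h (g 0), iso_apply g (h 0), map_add] at h1
  set y := rot g⁻¹ (g 0) with hy
  have hgy : rot g y = g 0 := by rw [hy, rot_rot_inv]
  have h2 : rot k (rot h (g 0)) = rot g (rot h y) := by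
    conv_lhs => rw [← hgy]
    have hkh : k * (h * g) = g * h := by rw [hk]; group
    rw [← rot_mul_apply, ← rot_mul_apply, mul_assoc, hkh, rot_mul_apply]
  have h3 : k 0 - (rot g - 1) (h 0) = -(rot k (h 0) - h 0) - rot g (rot h y - y) := by
    change k 0 - (rot g (h 0) - h 0) = _
    rw [map_sub, hgy, ← h2, eq_sub_of_add_eq' h1]
    abel
  rw [h3]
  refine (norm_sub_le _ _).trans (add_le_add ?_ ?_)
  · rw [norm_neg]
    exact norm_rot_sub_le k _
  · rw [norm_rot_apply]
    refine (norm_rot_sub_le h y).trans_eq ?_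
    rw [hy, norm_rot_apply]

end Bieberbach

/-! ### Buser's argument, finiteness of the point group, and the Bravais lattice. -/

section Bieberbach

variable {n : ℕ} {Γ : Subgroup (Iso n)}

theorem adjoint_rot (g : Iso n) : ContinuousLinearMap.adjoint (rot g) = rot g⁻¹ := by
  rw [eq_comm, ContinuousLinearMap.eq_adjoint_iff]
  intro x y
  rw [← (linPart g).inner_map_map]
  change inner ℝ (rot g (rot g⁻¹ x)) (rot g y) = _
  rw [rot_rot_inv]

theorem exists_norm_le_of_finite (hfin : ∀ r : ℝ, {g | g ∈ Γ ∧ ‖g 0‖ ≤ r}.Finite)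
    {S : Set (Iso n)} (hS : S ⊆ Γ) (hne : S.Nonempty) :
    ∃ g ∈ S, ∀ h ∈ S, ‖g 0‖ ≤ ‖h 0‖ := by
  obtain ⟨g₀, hg₀⟩ := hne
  obtain ⟨g, hg, hmin⟩ := Set.exists_min_image {g | g ∈ S ∧ ‖g 0‖ ≤ ‖g₀ 0‖} (fun g => ‖g 0‖)
    ((hfin ‖g₀ 0‖).subset fun g hg => ⟨hS hg.1, hg.2⟩) ⟨g₀, hg₀, le_rfl⟩
  refine ⟨g, hg.1, fun h hh => ?_⟩
  rcases le_total ‖h 0‖ ‖g₀ 0‖ with h1 | h1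
  · exact hmin h ⟨hh, h1⟩
  · exact hg.2.trans h1

/-- In a discrete cocompact group, an element whose linear part is close to the identity is a
translation (Buser's argument). -/
theorem linPart_eq_one_of_norm_le (hfin : ∀ r : ℝ, {g | g ∈ Γ ∧ ‖g 0‖ ≤ r}.Finite)
    (hmini : ∀ u : E n, ‖u‖ = 1 → ∀ ε > 0, ∀ δ > 0,
      ∃ g ∈ Γ, ∃ s > 0, ‖rot g - 1‖ ≤ ε ∧ ‖g 0 - s • u‖ ≤ δ * s)
    {g : Iso n} (hg : g ∈ Γ) (hg1 : ‖rot g - 1‖ ≤ 1 / 2) : linPart g = 1 := by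
  -- Choose `α`, a non-translation with small rotation and least displacement of the origin. Then
  -- choose `β` of least nonzero displacement among elements with nearly trivial rotation whose
  -- displacement lies mostly in the space where `rot α - 1` stretches by its norm. The commutator
  -- of `α` and `β` contradicts the choice of `β`.
  by_contra hne
  obtain ⟨α, ⟨hα, hα1, hαne⟩, hαmin⟩ := exists_norm_le_of_finite hfin
    (S := {g | g ∈ Γ ∧ ‖rot g - 1‖ ≤ 1 / 2 ∧ linPart g ≠ 1}) (fun g hg => hg.1) ⟨g, hg, hg1, hne⟩
  have hM0 : rot α - 1 ≠ 0 := fun h => hαne ((rot_eq_one_iff α).1 (sub_eq_zero.1 h))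
  obtain ⟨P, m', hm'0, hm', hPM, hP1, hP2, hPm, hPm', u, hu1, hu⟩ := exists_projection_gap hM0 (by
    intro x
    have : ContinuousLinearMap.adjoint (rot α - 1) = rot α⁻¹ - 1 := by
      rw [map_sub, adjoint_rot]
      congr 1
      exact ContinuousLinearMap.adjoint_id
    rw [this]
    change rot α (rot α⁻¹ x - x) - (rot α⁻¹ x - x) = rot α⁻¹ (rot α x - x) - (rot α x - x)
    rw [map_sub, map_sub, rot_inv_rot, rot_rot_inv]
    abel)
  set M := rot α - 1 with hM
  set m := ‖M‖ with hm
  obtain ⟨β, ⟨hβ, hβ1, hβ0, hβP⟩, hβmin⟩ := exists_norm_le_of_finite hfin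
    (S := {g | g ∈ Γ ∧ ‖rot g - 1‖ ≤ (m - m') / 8 ∧ g 0 ≠ 0 ∧ ‖g 0 - P (g 0)‖ ≤ ‖P (g 0)‖})
    (fun g hg => hg.1) (by
      obtain ⟨g, hg, s, hs, h1, h2⟩ := hmini u hu1 ((m - m') / 8) (by linarith) (1 / 2) (by norm_num)
      have hsu : ‖s • u‖ = s := by rw [norm_smul, hu1, mul_one, Real.norm_of_nonneg hs.le]
      have e1 : P (g 0) = s • u + P (g 0 - s • u) := by rw [map_sub, map_smul, hu]; abel
      have e2 : g 0 - P (g 0) = (g 0 - s • u) - P (g 0 - s • u) := by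
        rw [map_sub, map_smul, hu]; abel
      have e3 : s - 1 / 2 * s ≤ ‖P (g 0)‖ := by
        have := norm_sub_le_norm_add (s • u) (P (g 0 - s • u))
        rw [← e1, hsu] at this
        linarith [hP1 (g 0 - s • u)]
      have e4 : ‖g 0 - P (g 0)‖ ≤ 1 / 2 * s := by
        rw [e2]
        exact (hP2 _).trans h2
      refine ⟨g, hg, h1, fun h0 => ?_, by linarith⟩
      rw [h0, map_zero, norm_zero] at e3
      linarith)
  set b := β 0 with hb
  set k := α * β * α⁻¹ * β⁻¹ with hk
  have hkΓ : k ∈ Γ := Γ.mul_mem (Γ.mul_mem (Γ.mul_mem hα hβ) (Γ.inv_mem hα)) (Γ.inv_mem hβ)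
  have hkβ : ‖rot k - 1‖ ≤ ‖rot β - 1‖ := by
    have := norm_rot_commutator_sub_one_le α β
    rw [← hk, ← hM, ← hm] at this
    nlinarith [norm_nonneg (rot β - 1)]
  set w := k 0 - M b with hw
  have hwb : ‖w‖ ≤ (m - m') / 4 * ‖b‖ := by
    have h1 := norm_commutator_sub_le α β
    rw [← hk, ← hM, ← hb, ← hw] at h1
    -- For a translation `β` the error term vanishes; otherwise minimality of `α` bounds `‖α 0‖` by
    -- `‖b‖`.
    by_cases hβt : linPart β = 1
    · have h2 : ‖rot β - 1‖ = 0 := by rw [(rot_eq_one_iff β).2 hβt, sub_self, norm_zero]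
      have h3 : ‖rot k - 1‖ = 0 := le_antisymm (h2 ▸ hkβ) (norm_nonneg _)
      rw [h2, h3, zero_mul, zero_mul, add_zero] at h1
      exact h1.trans (mul_nonneg (by linarith) (norm_nonneg _))
    · have h2 : ‖α 0‖ ≤ ‖b‖ := hαmin β ⟨hβ, by linarith, hβt⟩
      have h3 : ‖rot k - 1‖ * ‖b‖ ≤ (m - m') / 8 * ‖b‖ :=
        mul_le_mul_of_nonneg_right (hkβ.trans hβ1) (norm_nonneg _)
      have h4 : ‖rot β - 1‖ * ‖α 0‖ ≤ (m - m') / 8 * ‖b‖ :=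
        mul_le_mul hβ1 h2 (norm_nonneg _) (by linarith)
      linarith
  have hb2 : ‖b‖ ≤ 2 * ‖P b‖ := by
    have := norm_add_le (P b) (b - P b)
    rw [add_sub_cancel] at this
    linarith
  have hbpos : 0 < ‖b‖ := norm_pos_iff.2 hβ0
  have hk0 : k 0 = M b + w := by rw [hw]; abel
  have hwP : ‖w‖ ≤ (m - m') / 2 * ‖P b‖ := by nlinarith
  have e1 : m * ‖P b‖ - ‖w‖ ≤ ‖P (k 0)‖ := by
    rw [hk0, map_add, hPM, ← hPm]
    have := norm_sub_le_norm_add (M (P b)) (P w)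
    linarith [hP1 w]
  have e2 : ‖k 0 - P (k 0)‖ ≤ m' * ‖P b‖ + ‖w‖ := by
    have : k 0 - P (k 0) = M (b - P b) + (w - P w) := by
      have h1 : P (k 0) = M (P b) + P w := by rw [hk0, map_add, hPM]
      rw [h1, map_sub M, hw]
      abel
    rw [this]
    refine (norm_add_le _ _).trans (add_le_add ((hPm' b).trans ?_) (hP2 w))
    exact mul_le_mul_of_nonneg_left hβP hm'0
  have e3 : ‖k 0‖ < ‖b‖ := by
    rw [hk0]
    have h1 := norm_add_le (M b) w
    have h2 := M.le_opNorm b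
    have h3 : m * ‖b‖ ≤ 1 / 2 * ‖b‖ := mul_le_mul_of_nonneg_right hα1 hbpos.le
    have h4 : (m - m') / 4 * ‖b‖ ≤ 1 / 4 * ‖b‖ :=
      mul_le_mul_of_nonneg_right (by linarith) hbpos.le
    linarith
  -- The bound `(m - m') / 8` makes `‖w‖` at most `(m - m') / 2 * ‖P b‖`. Hence the `P`-part of `k
  -- 0` is at least `(m + m') / 2 * ‖P b‖` and the complementary part at most that, so `k` competes
  -- with `β`, with smaller displacement.
  refine absurd (hβmin k ⟨hkΓ, hkβ.trans hβ1, fun h0 => ?_, by nlinarith⟩) (not_le.2 e3)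
  rw [h0, map_zero, norm_zero] at e1
  have : 0 < (m + m') / 2 * ‖P b‖ := mul_pos (by linarith) (by linarith)
  linarith

/-- A cocompact group of isometries has elements with linear part close to the identity moving the
origin in a direction close to a prescribed one. -/
theorem exists_rot_near_one_of_cocompact {d : ℝ} (hd : ∀ z : E n, ∃ g ∈ Γ, ‖g 0 - z‖ ≤ d)
    (u : E n) {ε δ : ℝ} (hε : 0 < ε) (hδ : 0 < δ) :
    ∃ g ∈ Γ, ∃ s > 0, ‖rot g - 1‖ ≤ ε ∧ ‖g 0 - s • u‖ ≤ δ * s := by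
  -- Elements `g k` carry the origin near `k • u`. Their linear parts subconverge, so for a fixed
  -- `i` and a much later `j` the quotient `g j * (g i)⁻¹` has small rotation and displacement close
  -- to `(j - i) • u`, with error at most `2 d + 2 ‖g i 0‖` independently of `j`.
  choose g hg hgd using fun k : ℕ => hd ((k : ℝ) • u)
  obtain ⟨A, -, φ, hφ, hlim⟩ := tendsto_subseq_of_bounded
    (Metric.isBounded_closedBall (x := (0 : E n →L[ℝ] E n)) (r := 1)) (x := fun k => rot (g k))
    (fun k => mem_closedBall_zero_iff.2 (norm_rot_le _))
  obtain ⟨N, hN⟩ := Metric.cauchySeq_iff'.1 hlim.cauchySeq ε hε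
  set i := φ N with hi
  obtain ⟨m, hm⟩ := exists_nat_gt ((d + d + 2 * ‖g i 0‖) / δ + i + N)
  set j := φ m with hj
  have hd0 : 0 ≤ d := (norm_nonneg _).trans (hgd 0)
  have hmj : (m : ℝ) ≤ j := by exact_mod_cast hφ.le_apply
  have hq : 0 ≤ (d + d + 2 * ‖g i 0‖) / δ := by positivity
  have hNm : N ≤ m := by
    have : (N : ℝ) ≤ m := by linarith [Nat.cast_nonneg (α := ℝ) i]
    exact_mod_cast this
  have hs : (d + d + 2 * ‖g i 0‖) / δ < (j : ℝ) - i := by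
    linarith [Nat.cast_nonneg (α := ℝ) N]
  refine ⟨g j * (g i)⁻¹, Γ.mul_mem (hg j) (Γ.inv_mem (hg i)), (j : ℝ) - i, by linarith, ?_, ?_⟩
  · refine (norm_rot_mul_inv_sub_one_le _ _).trans ?_
    rw [← dist_eq_norm]
    exact (hN m hNm).le
  · have h1 : (g j * (g i)⁻¹) 0 = g j 0 - rot (g j * (g i)⁻¹) (g i 0) := by
      rw [eq_sub_iff_add_eq', ← iso_apply, ← iso_mul_apply, inv_mul_cancel_right]
    have h2 : (g j * (g i)⁻¹) 0 - ((j : ℝ) - i) • u =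
        (g j 0 - (j : ℝ) • u) - (g i 0 - (i : ℝ) • u) +
          (g i 0 - rot (g j * (g i)⁻¹) (g i 0)) := by
      rw [h1, sub_smul]; abel
    rw [div_lt_iff₀ hδ] at hs
    rw [h2]
    calc _ ≤ ‖g j 0 - (j : ℝ) • u‖ + ‖g i 0 - (i : ℝ) • u‖ +
          (‖g i 0‖ + ‖rot (g j * (g i)⁻¹) (g i 0)‖) :=
        (norm_add_le _ _).trans (add_le_add (norm_sub_le _ _) (norm_sub_le _ _))
      _ ≤ d + d + (‖g i 0‖ + ‖g i 0‖) := by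
        rw [norm_rot_apply]
        gcongr
        · exact hgd j
        · exact hgd i
      _ ≤ _ := by linarith

/-- Discreteness in the compact-open topology. -/
theorem exists_eq_one_of_near_one (hΓ : DiscreteTopology Γ) :
    ∃ ε > 0, ∃ ρ > 0, ∀ g ∈ Γ, (∀ x, ‖x‖ ≤ ρ → ‖g x - x‖ < ε) → g = 1 := by
  obtain ⟨V, hV, hV1⟩ := isOpen_induced_iff.1 (isOpen_discrete ({1} : Set Γ))
  have h1 : V ∈ nhds (1 : Iso n) := hV.mem_nhds (by
    have : (1 : Γ) ∈ (Subtype.val ⁻¹' V : Set Γ) := hV1 ▸ rfl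
    exact this)
  rw [nhds_induced, ((nhds_basis_uniformity
    Metric.uniformity_basis_dist.compactConvergenceUniformity).comap _).mem_iff] at h1
  obtain ⟨⟨K, ε⟩, ⟨hK, hε⟩, hsub⟩ := h1
  obtain ⟨ρ, hρ0, hρ⟩ := hK.isBounded.exists_pos_norm_le
  refine ⟨ε, hε, ρ, hρ0, fun g hg h => ?_⟩
  have h2 : g ∈ V := hsub fun x hx => by
    change dist (g x) x < ε
    rw [dist_eq_norm]
    exact h x (hρ x hx)
  have h3 : (⟨g, hg⟩ : Γ) ∈ (Subtype.val ⁻¹' V : Set Γ) := h2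
  rw [hV1] at h3
  exact congrArg Subtype.val h3

/-- Pairs (linear part, image of the origin) stay bounded in a finite-dimensional space. Infinitely
many elements would include two distinct `s`, `t` so close that `s⁻¹ * t` is near the identity on a
large ball, hence trivial by discreteness. -/
theorem finite_norm_le_of_discrete (hΓ : DiscreteTopology Γ) (r : ℝ) :
    {g | g ∈ Γ ∧ ‖g 0‖ ≤ r}.Finite := by
  obtain ⟨ε, hε, ρ, hρ0, h⟩ := exists_eq_one_of_near_one hΓ
  by_contra hinf
  let f : Iso n → (E n →L[ℝ] E n) × E n := fun g => (rot g, g 0)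
  obtain ⟨s, hs, t, ht, hst, hd⟩ := exists_ne_dist_lt hinf (f := f)
    ((Metric.isBounded_closedBall (x := 0) (r := max 1 r)).subset (by
      rintro _ ⟨g, hg, rfl⟩
      rw [mem_closedBall_zero_iff, Prod.norm_def]
      exact max_le_max (norm_rot_le g) hg.2)) (ε := ε / (ρ + 1)) (by positivity)
  rw [Prod.dist_eq, max_lt_iff, dist_eq_norm, dist_eq_norm] at hd
  apply hst
  refine (inv_mul_eq_one.1 (h (s⁻¹ * t) (Γ.mul_mem (Γ.inv_mem hs.1) ht.1) fun x hx => ?_))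
  have h1 : ‖(s⁻¹ * t) x - x‖ = ‖t x - s x‖ := by
    have hx : x = s⁻¹ (s x) := (s.symm_apply_apply x).symm
    conv_lhs => rw [iso_mul_apply]; enter [1, 2]; rw [hx]
    rw [← dist_eq_norm, ← dist_eq_norm]
    exact s⁻¹.dist_map _ _
  have h2 : t x - s x = -((rot s - rot t) x) - (s 0 - t 0) := by
    change _ = -(rot s x - rot t x) - _
    rw [iso_apply t, iso_apply s x]; abel
  rw [h1, h2]
  refine (norm_sub_le _ _).trans_lt ?_
  rw [norm_neg]
  have h3 : ‖(rot s - rot t) x‖ ≤ ε / (ρ + 1) * ρ :=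
    ((rot s - rot t).le_opNorm x).trans (mul_le_mul hd.1.le hx (norm_nonneg _) (by positivity))
  calc _ < ε / (ρ + 1) * ρ + ε / (ρ + 1) := add_lt_add_of_le_of_lt h3 hd.2
    _ = ε := by field_simp

/-- The images of the balls about the origin form an increasing open cover of the compact orbit
space, so one of them covers it. -/
theorem exists_norm_sub_le_of_cocompact (hΓ : CompactSpace (Quotient (orbitSetoid Γ))) :
    ∃ d : ℝ, ∀ z : E n, ∃ g ∈ Γ, ‖g 0 - z‖ ≤ d := by
  let B : ℕ → Set (Quotient (orbitSetoid Γ)) := fun k =>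
    (Quotient.mk (orbitSetoid Γ)) '' Metric.ball 0 k
  have hpre : ∀ k, Quotient.mk (orbitSetoid Γ) ⁻¹' B k =
      ⋃ g ∈ Γ, (g : E n → E n) ⁻¹' Metric.ball 0 k := by
    intro k
    ext z
    simp only [B, Set.mem_preimage, Set.mem_image, Set.mem_iUnion, exists_prop]
    constructor
    · rintro ⟨y, hy, hyz⟩
      obtain ⟨g, hg, rfl⟩ := Quotient.exact hyz
      exact ⟨g, hg, hy⟩
    · rintro ⟨g, hg, hy⟩
      exact ⟨g z, hy, Quotient.sound ⟨g, hg, rfl⟩⟩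
  have hopen : ∀ k, IsOpen (B k) := by
    intro k
    rw [← isQuotientMap_quotient_mk'.isOpen_preimage]
    change IsOpen (Quotient.mk (orbitSetoid Γ) ⁻¹' B k)
    rw [hpre]
    exact isOpen_biUnion fun g _ => Metric.isOpen_ball.preimage g.continuous
  obtain ⟨k, hk⟩ := isCompact_univ.elim_directed_cover B hopen (by
    intro q _
    obtain ⟨z, rfl⟩ := Quotient.exists_rep q
    obtain ⟨k, hk⟩ := exists_nat_gt ‖z‖
    exact Set.mem_iUnion.2 ⟨k, z, mem_ball_zero_iff.2 hk, rfl⟩) (directed_of_isDirected_le (by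
    intro k l hkl
    exact Set.image_mono (Metric.ball_subset_ball (by exact_mod_cast hkl))))
  refine ⟨k, fun z => ?_⟩
  have hz : z ∈ Quotient.mk (orbitSetoid Γ) ⁻¹' B k := hk (Set.mem_univ _)
  rw [hpre] at hz
  simp only [Set.mem_iUnion, Set.mem_preimage, mem_ball_zero_iff, exists_prop] at hz
  obtain ⟨g, hg, h⟩ := hz
  refine ⟨g⁻¹, Γ.inv_mem hg, ?_⟩
  rw [← dist_eq_norm, ← g.dist_map]
  rw [← iso_mul_apply, mul_inv_cancel, dist_comm, dist_eq_norm]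
  simpa using h.le

namespace IsCrystalGroup

theorem linPart_eq_one (hΓ : IsCrystalGroup Γ) {g : Iso n} (hg : g ∈ Γ)
    (h : ‖rot g - 1‖ ≤ 1 / 2) : linPart g = 1 := by
  obtain ⟨d, hd⟩ := exists_norm_sub_le_of_cocompact hΓ.cocompact
  exact linPart_eq_one_of_norm_le (finite_norm_le_of_discrete hΓ.discrete)
    (fun u _ ε hε δ hδ => exists_rot_near_one_of_cocompact hd u hε hδ) hg h

/-- The point group of a crystal group is finite. -/
theorem finite_pointGroup (hΓ : IsCrystalGroup Γ) : Finite (pointGroup Γ) := by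
  have hlift : ∀ L : pointGroup Γ, ∃ g ∈ Γ, linPart g = L := fun L => L.2
  choose f hf hfL using hlift
  by_contra hinf
  rw [not_finite_iff_infinite] at hinf
  obtain ⟨L, -, M, -, hLM, hd⟩ := exists_ne_dist_lt (Set.infinite_univ (α := pointGroup Γ))
    (f := fun L => rot (f L)) ((Metric.isBounded_closedBall (x := 0) (r := 1)).subset (by
      rintro _ ⟨L, -, rfl⟩
      exact mem_closedBall_zero_iff.2 (norm_rot_le _))) (ε := 1 / 2) (by norm_num)
  have h1 := hΓ.linPart_eq_one (Γ.mul_mem (hf L) (Γ.inv_mem (hf M)))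
    ((norm_rot_mul_inv_sub_one_le _ _).trans (by rw [← dist_eq_norm]; exact hd.le))
  rw [map_mul, map_inv, hfL, hfL] at h1
  exact hLM (Subtype.ext (mul_inv_eq_one.1 h1))

end IsCrystalGroup

theorem eq_trans_of_linPart_eq_one {g : Iso n} (hg : linPart g = 1) : g = trans (g 0) := by
  ext1 z
  rw [iso_apply, (rot_eq_one_iff g).2 hg]
  exact add_comm _ _

theorem trans_apply (x z : E n) : trans x z = x + z := rfl

namespace IsCrystalGroup

/-- The Bravais lattice of a crystal group spans the space. -/
theorem span_bravais (hΓ : IsCrystalGroup Γ) :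
    Submodule.span ℝ (bravais Γ : Set (E n)) = ⊤ := by
  obtain ⟨d, hd⟩ := exists_norm_sub_le_of_cocompact hΓ.cocompact
  rw [← Submodule.orthogonal_eq_bot_iff]
  by_contra hne
  obtain ⟨v, hv, hv0⟩ := Submodule.exists_mem_ne_zero_of_ne_bot hne
  -- If `v` were orthogonal to the lattice, an element with small rotation and displacement close to
  -- `s • v` would be a lattice translation, so its displacement would be both orthogonal to `v` and
  -- nearly parallel to it.
  obtain ⟨g, hg, s, hs, h1, h2⟩ := exists_rot_near_one_of_cocompact hd v
    (ε := 1 / 2) (δ := ‖v‖ / 2) (by norm_num) (half_pos (norm_pos_iff.2 hv0))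
  have hgL : g 0 ∈ bravais Γ := by
    change trans (g 0) ∈ Γ
    rwa [← eq_trans_of_linPart_eq_one (hΓ.linPart_eq_one hg h1)]
  have h3 : inner ℝ (g 0) v = 0 :=
    Submodule.inner_right_of_mem_orthogonal (Submodule.subset_span hgL) hv
  have h4 := abs_real_inner_le_norm (g 0 - s • v) v
  rw [inner_sub_left, h3, real_inner_smul_left, real_inner_self_eq_norm_sq, zero_sub, abs_neg,
    abs_of_nonneg (by positivity)] at h4
  have h5 : ‖g 0 - s • v‖ * ‖v‖ ≤ ‖v‖ / 2 * s * ‖v‖ :=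
    mul_le_mul_of_nonneg_right h2 (norm_nonneg _)
  have h6 : 0 < s * ‖v‖ ^ 2 := by have := norm_pos_iff.2 hv0; positivity
  nlinarith

theorem discreteTopology_bravais (hΓ : IsCrystalGroup Γ) :
    DiscreteTopology (AddSubgroup.toIntSubmodule (bravais Γ)) := by
  obtain ⟨ε, hε, ρ, hρ0, h⟩ := exists_eq_one_of_near_one hΓ.discrete
  refine DiscreteTopology.of_forall_le_norm hε fun x hx => ?_
  by_contra! hlt
  apply hx
  have h1 := h (trans (x : E n)) x.2 fun z _ => by
    rw [trans_apply, add_sub_cancel_right]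
    exact hlt
  have h2 := DFunLike.congr_fun h1 (0 : E n)
  rw [trans_apply, add_zero] at h2
  exact Subtype.ext h2

end IsCrystalGroup

end Bieberbach

/-! ### Characters of `T`, the dual lattice, and the Dirichlet domain of the dual group. -/

section Characters

variable {n : ℕ} {Γ : Subgroup (Iso n)}

theorem linPart_trans (x : E n) : linPart (trans x) = 1 := rfl

theorem vecPart_trans (x : E n) : vecPart (trans x) = x := by
  rw [vecPart_eq_iff, linPart_trans, trans_apply, add_zero]
  rfl

theorem eq_trans_vecPart {g : Iso n} (hg : linPart g = 1) : g = trans (vecPart g) := by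
  ext1 z
  rw [apply_eq, hg, trans_apply, add_comm]
  rfl

theorem vecPart_mem_bravais (t : T Γ) : vecPart (t : Γ).1 ∈ bravais Γ := by
  change trans _ ∈ Γ
  rw [← eq_trans_vecPart (mem_T_iff.1 t.2)]
  exact t.1.2

/-- The translations of `Γ` as a homomorphic image of the Bravais lattice. -/
def bravaisHom (Γ : Subgroup (Iso n)) : Multiplicative (bravais Γ) →* T Γ where
  toFun x := ⟨⟨trans (x.toAdd : E n), x.toAdd.2⟩, mem_T_iff.2 rfl⟩
  map_one' := Subtype.ext <| Subtype.ext <| by ext1 z; exact zero_add z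
  map_mul' x y := Subtype.ext <| Subtype.ext <| by ext1 z; exact add_assoc _ _ z

theorem vecPart_bravaisHom (x : Multiplicative (bravais Γ)) :
    vecPart (bravaisHom Γ x : Γ).1 = (x.toAdd : E n) :=
  vecPart_trans _

theorem bravaisHom_surjective : Function.Surjective (bravaisHom Γ) := fun t =>
  ⟨Multiplicative.ofAdd ⟨_, vecPart_mem_bravais t⟩,
    Subtype.ext <| Subtype.ext (eq_trans_vecPart (mem_T_iff.1 t.2)).symm⟩

theorem chiT_apply (ω : E n) (t : T Γ) :
    chiT Γ ω t = Real.fourierChar (inner ℝ ω (vecPart (t : Γ).1)) := rfl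

theorem fourierChar_eq_one_iff (r : ℝ) : Real.fourierChar r = 1 ↔ ∃ m : ℤ, r = m := by
  rw [Real.fourierChar_apply', Circle.exp_eq_one]
  refine exists_congr fun m => ?_
  rw [mul_comm, mul_left_inj' Real.two_pi_pos.ne']

/-- Two points define the same character of `T` if and only if they differ by an element of the
dual lattice. -/
theorem chiT_eq_iff (ω ω' : E n) : chiT Γ ω = chiT Γ ω' ↔ ω - ω' ∈ dualLattice Γ := by
  have key : ∀ x : E n, Real.fourierChar (inner ℝ ω x) = Real.fourierChar (inner ℝ ω' x) ↔
      ∃ m : ℤ, inner ℝ x (ω - ω') = m := by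
    intro x
    rw [← div_eq_one, ← AddChar.map_sub_eq_div, fourierChar_eq_one_iff, ← inner_sub_left,
      real_inner_comm]
  constructor
  · intro h x hx
    refine (key x).1 ?_
    have := DFunLike.congr_fun h (bravaisHom Γ (Multiplicative.ofAdd ⟨x, hx⟩))
    rwa [chiT_apply, chiT_apply, vecPart_bravaisHom] at this
  · intro h
    ext1 t
    exact (key _).2 (h _ (vecPart_mem_bravais t))

/-- Conjugating a translation by `g⁻¹` applies the inverse of the linear part to its vector, and
orthogonality moves that linear part onto `ω`. -/
theorem conjChar_chiT (g : Γ) (ω : E n) : conjChar g (chiT Γ ω) = chiT Γ (linPart (g : Iso n) ω) := by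
  ext1 t
  change chiT Γ ω ((MulAut.conjNormal g⁻¹ : MulAut (T Γ)) t) = _
  rw [chiT_apply, chiT_apply, MulAut.conjNormal_apply, inv_inv]
  have ht : linPart (t : Γ).1 = 1 := mem_T_iff.1 t.2
  have h : vecPart (g⁻¹ * (t : Γ) * g : Γ).1 =
      (linPart (g : Iso n))⁻¹ (vecPart (t : Γ).1) := by
    change vecPart ((g : Iso n)⁻¹ * (t : Γ).1 * (g : Iso n)) = _
    rw [vecPart_mul, vecPart_mul, ht, vecPart_inv, inv_one, map_add]
    have : (linPart (g : Iso n))⁻¹ (-(linPart (g : Iso n) (vecPart (g : Iso n)))) =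
        -vecPart (g : Iso n) := by
      rw [map_neg]
      exact congrArg _ ((linPart (g : Iso n)).symm_apply_apply _)
    change (linPart (g : Iso n))⁻¹ (-(linPart (g : Iso n) (vecPart (g : Iso n)))) + _ + _ = _
    rw [this]
    abel
  rw [h, ← (linPart (g : Iso n)).inner_map_map]
  congr 2
  exact (linPart (g : Iso n)).apply_symm_apply _

theorem mem_stab_iff {χ : T Γ →* Circle} {g : Γ} :
    g ∈ stab χ ↔ ∀ t, χ ((MulAut.conjNormal g⁻¹ : MulAut (T Γ)) t) = χ t :=
  DFunLike.ext_iff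

namespace IsCrystalGroup

theorem isZLattice_bravais (hΓ : IsCrystalGroup Γ)
    [DiscreteTopology (AddSubgroup.toIntSubmodule (bravais Γ))] :
    IsZLattice ℝ (AddSubgroup.toIntSubmodule (bravais Γ)) where
  span_top := hΓ.span_bravais

theorem fg_T (hΓ : IsCrystalGroup Γ) : Group.FG (T Γ) := by
  have := hΓ.discreteTopology_bravais
  have h : Module.Finite ℤ (AddSubgroup.toIntSubmodule (bravais Γ)) := inferInstance
  have : AddGroup.FG (bravais Γ) := Module.Finite.iff_addGroup_fg.1 h
  exact Group.fg_of_surjective bravaisHom_surjective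

/-- Every character of `T` is of the form `χ_ω`. -/
theorem exists_eq_chiT (hΓ : IsCrystalGroup Γ) (χ : T Γ →* Circle) : ∃ ω, χ = chiT Γ ω := by
  have := hΓ.discreteTopology_bravais
  have := hΓ.isZLattice_bravais
  let b := Module.Free.chooseBasis ℤ (AddSubgroup.toIntSubmodule (bravais Γ))
  let B := b.ofZLatticeBasis ℝ (AddSubgroup.toIntSubmodule (bravais Γ))
  let toHom : (T Γ →* Circle) → (AddSubgroup.toIntSubmodule (bravais Γ) →+ Additive Circle) :=
    fun χ => (MonoidHom.toAdditiveRight (χ.comp (bravaisHom Γ)) : bravais Γ →+ Additive Circle)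
  have htoHom : ∀ χ x, toHom χ x =
      Additive.ofMul (χ (bravaisHom Γ (Multiplicative.ofAdd (x : bravais Γ)))) := fun _ _ => rfl
  -- A lattice basis is a basis of `ℝⁿ`, so a linear form can take prescribed values on it; the
  -- argument divided by `2π` is chosen so that the Fourier character recovers `χ`. Riesz
  -- representation gives `ω`.
  let θ : E n →ₗ[ℝ] ℝ := B.constr ℝ fun i => ((toHom χ (b i)).toMul : Circle).1.arg / (2 * Real.pi)
  let ω : E n := (InnerProductSpace.toDual ℝ (E n)).symm θ.toContinuousLinearMap
  have hω : ∀ x, inner ℝ ω x = θ x := fun x => InnerProductSpace.toDual_symm_apply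
  refine ⟨ω, ?_⟩
  have h1 : (toHom χ).toIntLinearMap = (toHom (chiT Γ ω)).toIntLinearMap := by
    refine b.ext fun i => ?_
    change toHom χ (b i) = toHom (chiT Γ ω) (b i)
    apply Additive.toMul.injective
    conv_rhs => rw [htoHom, toMul_ofMul, chiT_apply, vecPart_bravaisHom]
    change _ = Real.fourierChar (inner ℝ ω ((b i : bravais Γ) : E n))
    have hB : ((b i : bravais Γ) : E n) = B i := (b.ofZLatticeBasis_apply ℝ _ i).symm
    rw [hω, hB, B.constr_basis, Real.fourierChar_apply',
      mul_div_cancel₀ _ Real.two_pi_pos.ne', Circle.exp_arg]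
  ext1 t
  obtain ⟨x, rfl⟩ := bravaisHom_surjective t
  exact congrArg Additive.toMul (DFunLike.congr_fun h1 x.toAdd)

/-- A dual vector is determined by its integer inner products with a lattice basis. Countability
makes the boundary of the Dirichlet domain a countable union of null sets. -/
theorem countable_dualLattice (hΓ : IsCrystalGroup Γ) : Countable (dualLattice Γ) := by
  have := hΓ.discreteTopology_bravais
  have := hΓ.isZLattice_bravais
  let b := Module.Free.chooseBasis ℤ (AddSubgroup.toIntSubmodule (bravais Γ))
  let B := b.ofZLatticeBasis ℝ (AddSubgroup.toIntSubmodule (bravais Γ))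
  have hB : ∀ i, B i ∈ bravais Γ := fun i => by
    rw [b.ofZLatticeBasis_apply ℝ _ i]
    exact (b i).2
  choose f hf using fun (z : dualLattice Γ) i => z.2 (B i) (hB i)
  refine Function.Injective.countable (f := f) fun z w h => Subtype.ext ?_
  refine InnerProductSpace.ext_inner_left_basis B fun i => ?_
  rw [hf, hf, h]

theorem countable_dualGroup (hΓ : IsCrystalGroup Γ) : Countable (dualGroup Γ) := by
  have := hΓ.finite_pointGroup
  have := hΓ.countable_dualLattice
  let f : dualGroup Γ → dualLattice Γ × pointGroup Γ := fun g => (⟨_, g.2.1⟩, ⟨_, g.2.2⟩)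
  refine Function.Injective.countable (f := f) fun g h hgh => Subtype.ext ?_
  have h1 : vecPart g.1 = vecPart h.1 := congrArg (fun p => (p.1 : E n)) hgh
  have h2 : linPart g.1 = linPart h.1 := congrArg (fun p => (p.2 : E n ≃ₗᵢ[ℝ] E n)) hgh
  ext1 z
  rw [apply_eq, apply_eq, h1, h2]

theorem finite_quotient_T (hΓ : IsCrystalGroup Γ) (γ : CrossSection Γ) : Finite (Γ ⧸ T Γ) := by
  have := hΓ.finite_pointGroup
  exact Finite.of_surjective _ γ.bijective.2

end IsCrystalGroup

/-- The boundary of a Dirichlet domain is a null set. -/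
theorem volume_closure_dirichletDomain_diff {Δ : Subgroup (Iso n)} [Countable Δ] {a : E n}
    (ha : ∀ g ∈ Δ, g a = a → g = 1) :
    MeasureTheory.volume (closure (dirichletDomain Δ a) \ dirichletDomain Δ a) = 0 := by
  refine MeasureTheory.measure_mono_null
    (t := ⋃ g : {g : Δ // g ≠ 1}, AffineSubspace.perpBisector a ((g.1 : Iso n) a)) ?_ ?_
  · rintro y ⟨hy, hy'⟩
    simp only [dirichletDomain, Set.mem_ofPred_eq, not_forall] at hy'
    obtain ⟨g, hg, hg1, hlt⟩ := hy'
    refine Set.mem_iUnion.2 ⟨⟨⟨g, hg⟩, fun h => hg1 (congrArg Subtype.val h)⟩, ?_⟩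
    refine AffineSubspace.mem_perpBisector_iff_dist_eq.2 (le_antisymm ?_ (not_lt.1 hlt))
    have hc : IsClosed {y | dist y a ≤ dist y (g a)} :=
      isClosed_le (by fun_prop) (by fun_prop)
    exact closure_minimal (fun z hz => (hz g hg hg1).le) hc hy
  · refine MeasureTheory.measure_iUnion_null fun g => ?_
    -- The bisector is a proper affine subspace because it misses `a`, whose stabilizer is trivial.
    refine MeasureTheory.Measure.addHaar_affineSubspace _ _ fun htop => g.2 (Subtype.ext ?_)
    have h : a ∈ AffineSubspace.perpBisector a ((g.1 : Iso n) a) := htop ▸ AffineSubspace.mem_top _ _ _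
    rw [AffineSubspace.mem_perpBisector_iff_dist_eq, dist_self] at h
    exact ha _ g.1.2 (dist_eq_zero.1 h.symm).symm

/-- At a point of a Dirichlet domain of the dual group, the stabilizer of the character is `T`. -/
theorem mem_T_of_mem_dirichletDomain {a ω : E n} (hω : ω ∈ dirichletDomain (dualGroup Γ) a)
    {g : Γ} (hg : ∀ t, chiT Γ ω ((MulAut.conjNormal g⁻¹ : MulAut (T Γ)) t) = chiT Γ ω t) :
    g ∈ T Γ := by
  have h1 : conjChar g (chiT Γ ω) = chiT Γ ω := DFunLike.ext _ _ hg
  rw [conjChar_chiT, eq_comm, chiT_eq_iff] at h1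
  set L := linPart (g : Iso n) with hL
  have hLpt : L ∈ pointGroup Γ := ⟨g, g.2, rfl⟩
  -- Stabilizing `χ_ω` means `ω - L ω ∈ ℒ*`, which yields an element of `Γ*` with linear part `L`
  -- fixing `ω`. If it were nontrivial, the strict Dirichlet inequality at `ω` would fail, since `ω`
  -- is equidistant from `a` and `k a`.
  let k : Iso n := L.toAffineIsometryEquiv * trans (L.symm (ω - L ω))
  have hkL : linPart k = L := by
    change linPart L.toAffineIsometryEquiv * 1 = L
    rw [mul_one]
    rfl
  have hkω : k ω = ω := by
    change L (L.symm (ω - L ω) + ω) = ω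
    rw [map_add, L.apply_symm_apply, sub_add_cancel]
  have hkv : vecPart k = L.symm (ω - L ω) := by
    rw [vecPart_eq_iff, hkL]
    change L (L.symm (ω - L ω) + 0) = _
    rw [add_zero]
  have hk : k ∈ dualGroup Γ :=
    ⟨by rw [hkv]; exact dualLattice_pointGroup (inv_mem hLpt) h1, by rw [hkL]; exact hLpt⟩
  rw [mem_T_iff, ← hL, ← hkL]
  by_contra hne
  have h2 := hω k hk fun h => hne (by rw [h, map_one])
  rw [← k.dist_map ω a, hkω] at h2
  exact lt_irrefl _ h2

/-- Every `Γ`-orbit of characters of `T` is represented in the transversal `Ω`. -/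
theorem IsDualTransversal.exists_conjChar_eq {R ΩT Ω : Set (E n)} {h : IsParameterDomain Γ R ΩT}
    (hΩ : IsDualTransversal h Ω) (ω₀ : E n) :
    ∃ ω ∈ Ω, ∃ g : Γ, chiT Γ ω = conjChar g (chiT Γ ω₀) := by
  have key : ∀ {k : Iso n}, k ∈ dualTranslations Γ → ∀ z, chiT Γ (k z) = chiT Γ z := by
    intro k hk z
    rw [chiT_eq_iff, apply_eq, show linPart k = 1 from hk.2]
    change z + vecPart k - z ∈ _
    rw [add_sub_cancel_left]
    exact hk.1.1
  obtain ⟨ν, ⟨hν, k, hk, hkν⟩, -⟩ := h.fundamental ω₀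
  obtain ⟨ω, ⟨hω, L, hL⟩, -⟩ := hΩ.meets ν hν
  obtain ⟨⟨-, k', hk', hkω⟩, -⟩ := (h.fundamental ((L : E n ≃ₗᵢ[ℝ] E n) ν)).choose_spec
  obtain ⟨g, hg, hgL⟩ := L.2
  refine ⟨ω, hω, ⟨g, hg⟩, ?_⟩
  have h1 : k' ((L : E n ≃ₗᵢ[ℝ] E n) ν) = ω := hkω.trans hL
  have h2 : chiT Γ ω₀ = chiT Γ ν := by rw [← hkν, key hk]
  rw [h2, conjChar_chiT, ← h1, key hk', ← hgL]

end Characters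

/-! ### Assembly of the description of the dual. -/

theorem equivalent_U {n : ℕ} {Γ : Subgroup (Iso n)} (γ : CrossSection Γ) (χ : T Γ →* Circle) :
    (ind (UnitaryRep.ofCharacter χ)).Equivalent (U γ χ) :=
  ⟨W γ χ, fun g f =>
    congrArg (fun f => W γ χ (translate g f)) ((W γ χ).symm_apply_apply f).symm⟩

end Crystal

end

theorem mainTheorem5 (n : ℕ) (Γ : Subgroup (Crystal.Iso n)) (hΓ : Crystal.IsCrystalGroup Γ)
    (γ : Crystal.CrossSection Γ)
    (a : Crystal.E n) (ha : ∀ g ∈ Crystal.dualGroup Γ, g a = a → g = 1)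
    (R : Set (Crystal.E n)) (hR : R = Crystal.dirichletDomain (Crystal.dualGroup Γ) a)
    (ΩT : Set (Crystal.E n)) (hΩT : Crystal.IsParameterDomain Γ R ΩT)
    (Ω : Set (Crystal.E n)) (hΩ : Crystal.IsDualTransversal hΩT Ω) :
    MeasureTheory.volume (Ω \ R) = 0 ∧
    Crystal.dual Γ =
      {c | ∃ ω ∈ R, c = Crystal.repClass (Crystal.U γ (Crystal.chiT Γ ω))} ∪
      ⋃ ω ∈ Ω \ R, {c | ∃ σ : Crystal.UnitaryRep (Crystal.stab (Crystal.chiT Γ ω)),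
        Crystal.repClass σ ∈ Crystal.dualOver (Crystal.chiT Γ ω) ∧
        c = Crystal.repClass (Crystal.ind σ)} := by
  open Crystal in
  have := hΓ.countable_dualGroup
  have := hΓ.fg_T
  have hfin := hΓ.finite_quotient_T γ
  have hTidx : (T Γ).FiniteIndex := Subgroup.finiteIndex_of_finite_quotient
  have hstabT : ∀ ω ∈ R, ∀ g : Γ,
      (∀ t, chiT Γ ω ((MulAut.conjNormal g⁻¹ : MulAut (T Γ)) t) = chiT Γ ω t) → g ∈ T Γ :=
    fun ω hω g hg => mem_T_of_mem_dirichletDomain (hR ▸ hω) hg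
  have := Fintype.ofFinite (Γ ⧸ T Γ)
  have hidx : ∀ χ : T Γ →* Circle, (stab χ).FiniteIndex := fun χ =>
    Subgroup.finiteIndex_of_le (T_le_stab χ)
  refine ⟨?_, Set.Subset.antisymm ?_ ?_⟩
  · refine MeasureTheory.measure_mono_null ?_ (volume_closure_dirichletDomain_diff ha)
    rw [← hR]
    exact Set.sdiff_subset_sdiff_left hΩ.upper
  · rintro _ ⟨π, hπ, rfl⟩
    obtain ⟨χ, v, hv0, hv⟩ := hπ.exists_character (T Γ) T_comm
    obtain ⟨ω₀, rfl⟩ := hΓ.exists_eq_chiT χ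
    obtain ⟨ω, hω, g, hg⟩ := hΩ.exists_conjChar_eq ω₀
    -- `π(g)` carries the `χ_ω₀`-isotypic subspace into that of the conjugate character `χ_ω`, so
    -- the latter is nonzero.
    have hne : π.isotypic (chiT Γ ω) ≠ ⊥ := by
      rw [Submodule.ne_bot_iff]
      refine ⟨π.act g v, π.act_mem_isotypic (χ := chiT Γ ω₀) (fun t => ?_) hv, fun h => hv0 ?_⟩
      · rw [hg]; rfl
      · exact (π.act g).map_eq_zero_iff.1 h
    by_cases hωR : ω ∈ R
    · left
      exact ⟨ω, hωR, Quotient.sound ((UnitaryRep.setoid Γ).trans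
        (equivalent_ind_ofCharacter hπ (hstabT ω hωR) hne) (equivalent_U γ _))⟩
    · right
      have := Fintype.ofFinite (Γ ⧸ stab (chiT Γ ω))
      obtain ⟨σ, hσ, hσχ, heq⟩ := exists_equivalent_ind hπ (T_le_stab (chiT Γ ω))
        (fun g => mem_stab_iff) hne
      refine Set.mem_biUnion ⟨hω, hωR⟩ ⟨σ, ⟨σ, hσ, ?_, rfl⟩, Quotient.sound heq⟩
      exact (UnitaryRep.isMultipleOf_ofCharacter_iff _ _).2 hσχ
  · rintro c (⟨ω, hω, rfl⟩ | hc)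
    · refine ⟨ind (UnitaryRep.ofCharacter (chiT Γ ω)), ?_,
        Quotient.sound ((UnitaryRep.setoid Γ).symm (equivalent_U γ _))⟩
      exact ind_isIrreducible (hNH := le_rfl) (χ := chiT Γ ω) (fun _ _ => rfl) (hstabT ω hω)
        (UnitaryRep.ofCharacter_isIrreducible _)
    · simp only [Set.mem_iUnion] at hc
      obtain ⟨ω, -, σ, ⟨σ', hσ', hmul, heq⟩, rfl⟩ := hc
      have := Fintype.ofFinite (Γ ⧸ stab (chiT Γ ω))
      -- Only the class of `σ` is known to lie in the dual over `χ_ω`, so irreducibility and the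
      -- action of `T` by `χ_ω` are carried over from the representative `σ'`.
      have heq' : σ'.Equivalent σ := (UnitaryRep.setoid _).symm (Quotient.exact heq)
      refine ⟨ind σ, ?_, rfl⟩
      refine ind_isIrreducible (hNH := T_le_stab _) (χ := chiT Γ ω) (fun t v => ?_)
        (fun g => mem_stab_iff.2) (hσ'.of_equivalent heq')
      have h1 := (UnitaryRep.isMultipleOf_ofCharacter_iff _ _).1 hmul t
      obtain ⟨V, hV⟩ := heq'
      obtain ⟨w, rfl⟩ := V.surjective v
      rw [← hV, ← map_smul]
      exact congrArg V (h1 w)
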